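/- Let $n\ge 3$ and $R>0$, and let $z$ be uniformly distributed on the sphere $\mathbb S^{n-1}(R)\subset\mathbb R^n$ of radius $R$ centred at $0$, i.e. $z$ has the law of $R\zeta/\|\zeta\|_2$ with $\zeta\sim N(0,I_n)$. For $f=(f_1,\dots,f_n):\mathbb S^{n-1}(R)\to\mathbb R^n$ and $x\in\mathbb S^{n-1}(R)$, let $\nabla f(x)\in\mathbb R^{n\times n}$ be the matrix with entries $(\nabla f(x))_{ij}=\partial_i \check f_j(x)$, where $\check f(x)=f(Rx/\|x\|_2)$ for $x\neq0$ (so the columns of $\nabla f$ are the gradients on the sphere of $f_1,\dots,f_n$, defined wherever $\check f$ is differentiable). Let $P_x^\perp=I_n-xx^\top/\|x\|_2^2$. Assume that either * $f$ is locally Lipschitz on $\mathbb S^{n-1}(R)$ and $\mathbb E[\|\nabla f(z)^\top\|_F^2]<\infty$; or * $f=\tilde f/\|\tilde f\|_2$ at the points of $\mathbb S^{n-1}(R)$ where $\tilde f\ne0$, for some $\tilde f$ with values in $\mathbb R^n$ that is locally Lipschitz on $\mathbb S^{n-1}(R)$ (for instance, the restriction of a locally Lipschitz map $\mathbb R^n\to\mathbb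 R^n$) and satisfies $\mathbb P(\tilde f(z)\ne 0)=1$ and $\mathbb E[\|\tilde f(z)\|_2^{-2}\|\nabla\tilde f(z)\|_F^2]<\infty$. Define $\xi_f(z)=f(z)^\top z-R^2n^{-1}\operatorname{tr}(\nabla f(z)^\top P_z^\perp)$. Then $\check f$ is differentiable at $z$ with probability one, all expectations below are finite, and $$\mathbb E\big[(\xi_f(z)-\mathbb E[f(z)]^\top z)^2\big]\le 2R^4(n^2-2n)^{-1}\,\mathbb E\big[\|\nabla f(z)^\top P_z^\perp\|_F^2\big],$$ $$\Big(\mathbb E\big|\|f(z)\|_2-\|\mathbb E[f(z)]\|_2\big|\Big)^2\le R^2(n-2)^{-1}\,\mathbb E\big[\|\nabla f(z)^\top P_z^\perp\|_F^2\big],$$ and the second bound also holds with the left-hand side replaced by $\mathbb E\big[\big|\|f(z)\|_2-\|\mathbb E[f(z)]\|_2\big|^2\big]$. -/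

import Mathlib

open MeasureTheory ProbabilityTheory
open scoped Matrix

/-- The uniform distribution on the sphere of radius `R` centred at `0` in `ℝⁿ`: the law of
`R ζ / ‖ζ‖₂` where `ζ ∼ N(0, Iₙ)`. -/
noncomputable def sphereUniform (n : ℕ) (R : ℝ) : Measure (EuclideanSpace ℝ (Fin n)) :=
  (stdGaussian (EuclideanSpace ℝ (Fin n))).map (fun x => (R / ‖x‖) • x)

/-- The extension `x ↦ f (R x / ‖x‖₂)` of a function on the sphere of radius `R`, constant along
rays. It depends on `f` only through its values on the sphere (for `x ≠ 0`). -/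
noncomputable def radialExt {n : ℕ} (R : ℝ)
    (f : EuclideanSpace ℝ (Fin n) → EuclideanSpace ℝ (Fin n)) :
    EuclideanSpace ℝ (Fin n) → EuclideanSpace ℝ (Fin n) :=
  fun x => f ((R / ‖x‖) • x)

/-- The gradient matrix `∇f(x)` of a vector field `f = (f₁, …, fₙ)` on the sphere of radius `R`.
Its columns are `∇f₁(x), …, ∇fₙ(x)`: the entry `(i, j)` is the partial derivative with respect to
the `i`-th coordinate of the `j`-th component of the radially constant extension of `f`. -/
noncomputable def sphereGrad {n : ℕ} (R : ℝ)
    (f : EuclideanSpace ℝ (Fin n) → EuclideanSpace ℝ (Fin n)) (x : EuclideanSpace ℝ (Fin n)) :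
    Matrix (Fin n) (Fin n) ℝ :=
  Matrix.of fun i j => (fderiv ℝ (radialExt R f) x (EuclideanSpace.single i (1 : ℝ))) j

/-- The matrix `P_x^⊥ = Iₙ - x xᵀ / ‖x‖₂²`. -/
noncomputable def projPerp {n : ℕ} (x : EuclideanSpace ℝ (Fin n)) : Matrix (Fin n) (Fin n) ℝ :=
  1 - (‖x‖ ^ 2)⁻¹ • Matrix.of fun i j => x i * x j

/-- The squared Frobenius norm of a matrix. -/
def frobSq {n : ℕ} (A : Matrix (Fin n) (Fin n) ℝ) : ℝ :=
  ∑ i, ∑ j, A i j ^ 2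

/-- `ξ_f(x) = f(x)ᵀ x - R² n⁻¹ trace (∇f(x)ᵀ P_x^⊥)`. -/
noncomputable def xiStein {n : ℕ} (R : ℝ)
    (f : EuclideanSpace ℝ (Fin n) → EuclideanSpace ℝ (Fin n)) (x : EuclideanSpace ℝ (Fin n)) : ℝ :=
  inner ℝ (f x) x - R ^ 2 * (n : ℝ)⁻¹ * ((sphereGrad R f x)ᵀ * projPerp x).trace

/-! The sphere inherits both bounds from Gaussian space. If ζ is standard Gaussian, the radially
constant extension F of f satisfies F(ζ) = f(Rζ/‖ζ‖), so F(ζ) has the law of f(z); moreover ‖ζ‖ and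
ζ/‖ζ‖ are independent, and ∇F is homogeneous of degree -1. Since E‖ζ‖⁻² = 1/(n-2), this gives
E‖∇F(ζ)‖² = R²/(n-2) · E‖∇f(z)‖² in Frobenius norm. As F is constant along rays, ∇f(x)ᵀ annihilates
x, so the projection P_x^⊥ changes nothing.

The second bound is the Gaussian Poincaré inequality E‖F - m‖² ≤ E‖∇F‖² with m = E F, together with
|‖f‖ - ‖m‖| ≤ ‖f - m‖.

The first bound uses the second order Stein inequality E(⟨g,ζ⟩ - div g)² ≤ E‖g‖² + E‖∇g‖² for g = F
- m; by Poincaré the right side is at most 2E‖∇F‖². With a = ⟨f(z) - m, z⟩ and D = tr ∇f(z),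
independence and E‖ζ‖² = n turn the left side into (n/R²)E a² - 2E aD + (R²/(n-2))E D². Lowering the
last coefficient to R²/n leaves the perfect square (n/R²)E(a - R²D/n)², and a - R²D/n is exactly
ξ_f(z) - ⟨m,z⟩.

The analytic work is to reach F, which is singular at the origin and, for a normalised field, also
over the zeros of the unnormalised one. The pair of Gaussian inequalities (`SteinPoincare`) is
proved for smooth compactly supported fields and carried through limits by
`SteinPoincare.of_tendsto`: mollification reaches Lipschitz fields, annular cutoffs reach radial
extensions (`ScaleLipschitz.steinPoincare`), and cutoffs in the target space reach normalised fields
(`RadiallyRegular.of_normalize`). -/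

/-! ### Gaussian density and integration by parts. -/

section GaussianDensity

variable {E : Type*} [NormedAddCommGroup E] [InnerProductSpace ℝ E] [FiniteDimensional ℝ E]
  [MeasurableSpace E] [BorelSpace E]

variable (E) in
/-- The normalizing constant `∫ exp (-‖x‖² / 2) dx` of the standard Gaussian density. -/
noncomputable def gaussNorm : ℝ := ∫ x : E, Real.exp (-(1 / 2) * ‖x‖ ^ 2)

/-- The density of the standard Gaussian distribution with respect to Lebesgue measure. -/
noncomputable def gaussDensity (x : E) : ℝ := (gaussNorm E)⁻¹ * Real.exp (-(1 / 2) * ‖x‖ ^ 2)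

lemma gaussNorm_pos : 0 < gaussNorm E := by
  rw [gaussNorm, GaussianFourier.integral_rexp_neg_mul_sq_norm (by norm_num)]
  positivity

lemma gaussDensity_pos (x : E) : 0 < gaussDensity x :=
  mul_pos (inv_pos.2 gaussNorm_pos) (Real.exp_pos _)

lemma continuous_gaussDensity : Continuous (gaussDensity : E → ℝ) := by
  unfold gaussDensity; fun_prop

lemma integrable_gaussDensity : Integrable (gaussDensity : E → ℝ) := by
  refine Integrable.const_mul ?_ _
  refine Integrable.of_integral_ne_zero ?_
  exact (gaussNorm_pos (E := E)).ne'

lemma hasFDerivAt_gaussDensity (x : E) :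
    HasFDerivAt (gaussDensity : E → ℝ) (-(gaussDensity x) • innerSL ℝ x) x := by
  have h : HasFDerivAt (fun y : E => ‖y‖ ^ 2) (2 • innerSL ℝ x) x :=
    (hasStrictFDerivAt_norm_sq x).hasFDerivAt
  have h2 := ((h.const_mul (-(1 / 2) : ℝ)).exp).const_mul (gaussNorm E)⁻¹
  refine h2.congr_fderiv ?_
  ext y
  simp [gaussDensity]
  ring

/-- Both sides are finite measures, so it suffices to match characteristic functions; the density
side is an explicit Gaussian Fourier integral. -/
theorem stdGaussian_eq_withDensity :
    stdGaussian E = volume.withDensity (fun x : E => ENNReal.ofReal (gaussDensity x)) := by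
  have : IsFiniteMeasure (volume.withDensity (fun x : E => ENNReal.ofReal (gaussDensity x))) :=
    isFiniteMeasure_withDensity_ofReal integrable_gaussDensity.2
  apply Measure.ext_of_charFun
  ext t
  rw [charFun_stdGaussian, charFun_apply, integral_withDensity_eq_integral_toReal_smul
    (continuous_gaussDensity.measurable.ennreal_ofReal) (by simp)]
  have hb : (0 : ℝ) < ((1 / 2 : ℂ)).re := by norm_num
  have h0 := GaussianFourier.integral_cexp_neg_mul_sq_norm_add hb 0 (0 : E)
  have h1 := GaussianFourier.integral_cexp_neg_mul_sq_norm_add hb Complex.I t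
  have hZ : (gaussNorm E : ℂ) =
      (Real.pi / (1 / 2 : ℂ)) ^ (Module.finrank ℝ E / 2 : ℂ) := by
    rw [gaussNorm, ← integral_complex_ofReal]
    simpa using h0
  have hZ0 : (gaussNorm E : ℂ) ≠ 0 := by exact_mod_cast gaussNorm_pos.ne'
  rw [← hZ] at h1
  have : ∀ x : E, (ENNReal.ofReal (gaussDensity x)).toReal •
      Complex.exp (↑(inner ℝ x t) * Complex.I) =
      (gaussNorm E : ℂ)⁻¹ *
        Complex.exp (-(1 / 2 : ℂ) * ‖x‖ ^ 2 + Complex.I * (inner ℝ t x : ℝ)) := by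
    intro x
    rw [ENNReal.toReal_ofReal (gaussDensity_pos x).le, gaussDensity, Complex.exp_add,
      real_inner_comm, Complex.real_smul]
    push_cast
    rw [mul_comm Complex.I]
    ring
  simp_rw [this]
  rw [integral_const_mul, h1]
  field_simp
  congr 1
  simp
  ring

lemma stdGaussian_absolutelyContinuous : stdGaussian E ≪ (volume : Measure E) := by
  rw [stdGaussian_eq_withDensity]
  exact withDensity_absolutelyContinuous _ _

lemma integral_stdGaussian {F : Type*} [NormedAddCommGroup F] [NormedSpace ℝ F] (f : E → F) :
    ∫ x, f x ∂stdGaussian E = ∫ x, gaussDensity x • f x := by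
  rw [stdGaussian_eq_withDensity, integral_withDensity_eq_integral_toReal_smul
    (continuous_gaussDensity.measurable.ennreal_ofReal) (by simp)]
  simp_rw [ENNReal.toReal_ofReal (gaussDensity_pos _).le]

lemma integrable_stdGaussian_iff {F : Type*} [NormedAddCommGroup F] [NormedSpace ℝ F]
    {f : E → F} :
    Integrable f (stdGaussian E) ↔ Integrable fun x => gaussDensity x • f x := by
  rw [stdGaussian_eq_withDensity, integrable_withDensity_iff_integrable_smul'
    (continuous_gaussDensity.measurable.ennreal_ofReal) (by simp)]
  simp_rw [ENNReal.toReal_ofReal (gaussDensity_pos _).le]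

/-- **Stein's lemma** for the standard Gaussian distribution. -/
theorem integral_mul_inner_stdGaussian {u : E → ℝ} {a : E} (hu : Differentiable ℝ u)
    (h : Integrable u (stdGaussian E))
    (h₁ : Integrable (fun x => u x * inner ℝ a x) (stdGaussian E))
    (h₂ : Integrable (fun x => fderiv ℝ u x a) (stdGaussian E)) :
    ∫ x, u x * inner ℝ a x ∂stdGaussian E = ∫ x, fderiv ℝ u x a ∂stdGaussian E := by
  have hd : ∀ x : E, fderiv ℝ (gaussDensity : E → ℝ) x a = -(gaussDensity x * inner ℝ a x) := by
    intro x
    rw [(hasFDerivAt_gaussDensity x).fderiv]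
    simp [real_inner_comm]
  rw [integrable_stdGaussian_iff] at h h₁ h₂
  simp only [smul_eq_mul] at h h₁ h₂
  -- Lebesgue integration by parts against the density, whose derivative along `a` is `-⟪a, x⟫`
  -- times itself.
  have key := integral_mul_fderiv_eq_neg_fderiv_mul_of_integrable (μ := (volume : Measure E))
    (f := u) (g := gaussDensity) (v := a)
    (by simpa only [mul_comm] using h₂)
    (by
      simp_rw [hd]
      refine h₁.neg.congr (.of_forall fun x => ?_)
      simp only [Pi.neg_apply]; ring)
    (by simpa only [mul_comm] using h)
    (fun x _ => hu x) (fun x _ => (hasFDerivAt_gaussDensity x).differentiableAt)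
  rw [integral_stdGaussian, integral_stdGaussian]
  simp_rw [hd] at key
  simp only [smul_eq_mul]
  have e1 : ∀ x : E, gaussDensity x * (u x * inner ℝ a x)
      = -(u x * -(gaussDensity x * inner ℝ a x)) := fun x => by ring
  simp_rw [e1, integral_neg, key, neg_neg, mul_comm]

lemma integrable_norm_pow_stdGaussian (k : ℕ) :
    Integrable (fun x : E => ‖x‖ ^ k) (stdGaussian E) :=
  (IsGaussian.memLp_id (stdGaussian E) k (by simp)).integrable_norm_pow'

end GaussianDensity

/-! ### The Gaussian Poincaré inequality by rotation. -/

section TestFunction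

open scoped ContDiff

variable {E : Type*} [NormedAddCommGroup E] [InnerProductSpace ℝ E]

/-- Smooth real-valued functions with compact support. -/
structure IsTestFun (u : E → ℝ) : Prop where
  contDiff : ContDiff ℝ ∞ u
  hasCompactSupport : HasCompactSupport u

namespace IsTestFun

variable {u v : E → ℝ}

lemma differentiable (hu : IsTestFun u) : Differentiable ℝ u :=
  hu.contDiff.differentiable (by simp)

lemma fderiv_apply (hu : IsTestFun u) (a : E) : IsTestFun fun x => fderiv ℝ u x a where
  contDiff := (hu.contDiff.fderiv_right (m := ∞) (by simp)).clm_apply contDiff_const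
  hasCompactSupport := hu.hasCompactSupport.fderiv_apply ℝ a

lemma mul (hu : IsTestFun u) (hv : ContDiff ℝ ∞ v) : IsTestFun fun x => u x * v x where
  contDiff := hu.contDiff.mul hv
  hasCompactSupport := hu.hasCompactSupport.mul_right

lemma sub (hu : IsTestFun u) (hv : IsTestFun v) : IsTestFun fun x => u x - v x where
  contDiff := hu.contDiff.sub hv.contDiff
  hasCompactSupport := hu.hasCompactSupport.sub hv.hasCompactSupport

lemma sum {ι : Type*} {s : Finset ι} {u : ι → E → ℝ} (hu : ∀ i, IsTestFun (u i)) :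
    IsTestFun fun x => ∑ i ∈ s, u i x where
  contDiff := ContDiff.sum fun i _ => (hu i).contDiff
  hasCompactSupport := by
    classical
    induction s using Finset.induction_on with
    | empty => simp only [Finset.sum_empty]; exact HasCompactSupport.zero
    | insert i s hi ih => simp only [Finset.sum_insert hi]; exact (hu i).hasCompactSupport.add ih

lemma exists_bound (hu : IsTestFun u) : ∃ C, ∀ x, |u x| ≤ C :=
  hu.contDiff.continuous.bounded_above_of_compact_support hu.hasCompactSupport

lemma exists_fderiv_bound (hu : IsTestFun u) : ∃ C, ∀ x, ‖fderiv ℝ u x‖ ≤ C :=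
  (hu.contDiff.continuous_fderiv (by simp)).bounded_above_of_compact_support
    (hu.hasCompactSupport.fderiv ℝ)

lemma continuous_fderiv (hu : IsTestFun u) : Continuous (fderiv ℝ u) :=
  hu.contDiff.continuous_fderiv (by simp)

variable [FiniteDimensional ℝ E] [MeasurableSpace E] [BorelSpace E]

lemma integrable (hu : IsTestFun u) : Integrable u (stdGaussian E) :=
  hu.contDiff.continuous.integrable_of_hasCompactSupport hu.hasCompactSupport

/-- Multiplication by `⟪a, x⟫` minus `∂_a` is adjoint to `∂_a` in the Gaussian `L²` space. -/
lemma integral_mul_adjoint (hu : IsTestFun u) (hv : IsTestFun v) (a : E) :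
    ∫ x, u x * (v x * inner ℝ a x - fderiv ℝ v x a) ∂stdGaussian E =
      ∫ x, fderiv ℝ u x a * v x ∂stdGaussian E := by
  have hi : ContDiff ℝ ∞ fun x : E => inner ℝ a x := contDiff_const.inner ℝ contDiff_id
  have huv := hu.mul hv.contDiff
  have hd : ∀ x, fderiv ℝ (fun x => u x * v x) x a
      = u x * fderiv ℝ v x a + fderiv ℝ u x a * v x := by
    intro x
    rw [fderiv_fun_mul (hu.differentiable x) (hv.differentiable x)]
    simp [mul_comm]
  have key := integral_mul_inner_stdGaussian (a := a) huv.differentiable huv.integrable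
    (huv.mul hi).integrable (huv.fderiv_apply a).integrable
  simp_rw [hd] at key
  rw [integral_add (hu.mul (hv.fderiv_apply a).contDiff).integrable
    ((hu.fderiv_apply a).mul hv.contDiff).integrable] at key
  have e : ∀ x, u x * (v x * inner ℝ a x - fderiv ℝ v x a) =
    u x * v x * inner ℝ a x - u x * fderiv ℝ v x a := fun x => by ring
  simp_rw [e]
  rw [integral_sub (huv.mul hi).integrable (hu.mul (hv.fderiv_apply a).contDiff).integrable, key]
  ring

end IsTestFun

lemma norm_rotation_snd_le (θ : ℝ) (x y : E) :
    ‖-Real.sin θ • x + Real.cos θ • y‖ ≤ ‖x‖ + ‖y‖ := by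
  refine (norm_add_le _ _).trans (add_le_add ?_ ?_)
  · rw [norm_smul, norm_neg]
    exact mul_le_of_le_one_left (norm_nonneg _) (Real.abs_sin_le_one θ)
  · rw [norm_smul]
    exact mul_le_of_le_one_left (norm_nonneg _) (Real.abs_cos_le_one θ)

variable [FiniteDimensional ℝ E] [MeasurableSpace E] [BorelSpace E]

/-- The interpolation `E[u(X) u(cos θ X + sin θ Y)]` between `E[u(X)²]` and `E[u(X)]²`. -/
noncomputable def gaussInterp (u : E → ℝ) (θ : ℝ) : ℝ :=
  ∫ p : E × E, u p.1 * u (Real.cos θ • p.1 + Real.sin θ • p.2)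
    ∂(stdGaussian E).prod (stdGaussian E)

lemma measurePreserving_rotation_stdGaussian (θ : ℝ) :
    MeasurePreserving (ContinuousLinearMap.rotation θ : E × E →L[ℝ] E × E)
      ((stdGaussian E).prod (stdGaussian E)) ((stdGaussian E).prod (stdGaussian E)) :=
  ⟨by fun_prop, IsGaussian.map_rotation_eq_self (by simp) θ⟩

lemma integral_rotation_stdGaussian (θ : ℝ) {F : E × E → ℝ} (hF : Continuous F) :
    ∫ p : E × E, F (Real.cos θ • p.1 + Real.sin θ • p.2, -Real.sin θ • p.1 + Real.cos θ • p.2)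
      ∂(stdGaussian E).prod (stdGaussian E) = ∫ p, F p ∂(stdGaussian E).prod (stdGaussian E) := by
  conv_rhs => rw [← (measurePreserving_rotation_stdGaussian (E := E) θ).map_eq]
  rw [integral_map (by fun_prop) hF.aestronglyMeasurable]
  rfl

lemma integrable_norm_add_norm_prod_stdGaussian :
    Integrable (fun p : E × E => ‖p.1‖ + ‖p.2‖) ((stdGaussian E).prod (stdGaussian E)) := by
  have h : Integrable (fun x : E => ‖x‖) (stdGaussian E) := by
    simpa using integrable_norm_pow_stdGaussian (E := E) 1
  exact (h.comp_fst _).add (h.comp_snd _)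

lemma IsTestFun.hasDerivAt_gaussInterp {u : E → ℝ} (hu : IsTestFun u) (θ : ℝ) :
    HasDerivAt (gaussInterp u)
      (∫ p : E × E, u p.1 * fderiv ℝ u (Real.cos θ • p.1 + Real.sin θ • p.2)
        (-Real.sin θ • p.1 + Real.cos θ • p.2) ∂(stdGaussian E).prod (stdGaussian E)) θ := by
  obtain ⟨M, hM⟩ := hu.exists_bound
  obtain ⟨C, hC⟩ := hu.exists_fderiv_bound
  have hM0 : 0 ≤ M := (abs_nonneg _).trans (hM 0)
  have hC0 : 0 ≤ C := (norm_nonneg _).trans (hC 0)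
  have hcu := hu.contDiff.continuous
  have hcu' := hu.continuous_fderiv
  refine (hasDerivAt_integral_of_dominated_loc_of_deriv_le (s := Set.univ)
    (μ := (stdGaussian E).prod (stdGaussian E))
    (F := fun (t : ℝ) (p : E × E) => u p.1 * u (Real.cos t • p.1 + Real.sin t • p.2))
    (F' := fun (t : ℝ) (p : E × E) => u p.1 * fderiv ℝ u (Real.cos t • p.1 + Real.sin t • p.2)
      (-Real.sin t • p.1 + Real.cos t • p.2))
    (bound := fun p : E × E => M * (C * (‖p.1‖ + ‖p.2‖))) Filter.univ_mem ?_ ?_ ?_ ?_ ?_ ?_).2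
  · exact .of_forall fun t => Continuous.aestronglyMeasurable (by fun_prop)
  · refine Integrable.mono' (integrable_const (M * M))
      (Continuous.aestronglyMeasurable (by fun_prop)) (.of_forall fun p => ?_)
    rw [norm_mul]
    exact mul_le_mul (hM _) (hM _) (norm_nonneg _) hM0
  · exact Continuous.aestronglyMeasurable (by fun_prop)
  · refine .of_forall fun p t _ => ?_
    rw [norm_mul]
    refine mul_le_mul (hM _) ?_ (norm_nonneg _) hM0
    refine ((fderiv ℝ u _).le_opNorm _).trans ?_
    exact mul_le_mul (hC _) (norm_rotation_snd_le _ _ _) (norm_nonneg _) hC0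
  · exact ((integrable_norm_add_norm_prod_stdGaussian (E := E)).const_mul C).const_mul M
  · refine .of_forall fun p t _ => ?_
    have h1 : HasDerivAt (fun t : ℝ => Real.cos t • p.1 + Real.sin t • p.2)
        (-Real.sin t • p.1 + Real.cos t • p.2) t :=
      ((Real.hasDerivAt_cos t).smul_const _).add ((Real.hasDerivAt_sin t).smul_const _)
    exact (((hu.differentiable (Real.cos t • p.1 + Real.sin t • p.2)).hasFDerivAt).comp_hasDerivAt
      t h1).const_mul (u p.1)

/-- Rotation invariance and Stein's lemma rewrite the derivative as -sin θ · E⟨∇u(X), ∇u(X')⟩ with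
X, X' standard Gaussian; then ⟨v, w⟩ ≤ (‖v‖² + ‖w‖²)/2. -/
lemma IsTestFun.le_deriv_gaussInterp {u : E → ℝ} (hu : IsTestFun u) {θ : ℝ}
    (hθ : 0 ≤ Real.sin θ) :
    -Real.sin θ * ∫ x, ‖fderiv ℝ u x‖ ^ 2 ∂stdGaussian E ≤ deriv (gaussInterp u) θ := by
  obtain ⟨M, hM⟩ := hu.exists_bound
  obtain ⟨C, hC⟩ := hu.exists_fderiv_bound
  have hM0 : 0 ≤ M := (abs_nonneg _).trans (hM 0)
  have hC0 : 0 ≤ C := (norm_nonneg _).trans (hC 0)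
  have hcu := hu.contDiff.continuous
  have hcu' := hu.continuous_fderiv
  rw [(hu.hasDerivAt_gaussInterp θ).deriv]
  -- In rotated coordinates the differential is evaluated at the first variable and applied to the
  -- independent second one, where Stein's lemma can act.
  have hrot := integral_rotation_stdGaussian θ (F := fun p : E × E =>
    u (Real.cos θ • p.1 - Real.sin θ • p.2) * fderiv ℝ u p.1 p.2) (by fun_prop)
  have hsimp : ∀ p : E × E, Real.cos θ • (Real.cos θ • p.1 + Real.sin θ • p.2) -
      Real.sin θ • (-Real.sin θ • p.1 + Real.cos θ • p.2) = p.1 := by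
    intro p
    have : Real.cos θ • (Real.cos θ • p.1 + Real.sin θ • p.2) -
      Real.sin θ • (-Real.sin θ • p.1 + Real.cos θ • p.2) =
        (Real.sin θ ^ 2 + Real.cos θ ^ 2) • p.1 := by module
    rw [this, Real.sin_sq_add_cos_sq, one_smul]
  simp only [hsimp] at hrot
  rw [hrot]
  have hint : Integrable (fun p : E × E => u (Real.cos θ • p.1 - Real.sin θ • p.2) *
      fderiv ℝ u p.1 p.2) ((stdGaussian E).prod (stdGaussian E)) := by
    refine Integrable.mono'
      (((integrable_norm_add_norm_prod_stdGaussian (E := E)).const_mul C).const_mul M)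
      (Continuous.aestronglyMeasurable (by fun_prop)) (.of_forall fun p => ?_)
    rw [norm_mul]
    refine mul_le_mul (hM _) ?_ (norm_nonneg _) hM0
    refine (ContinuousLinearMap.le_opNorm _ _).trans ?_
    exact mul_le_mul (hC _) (by linarith [norm_nonneg p.1]) (norm_nonneg _) hC0
  -- integration by parts in the second variable
  have hstein : ∀ x : E, ∫ y, u (Real.cos θ • x - Real.sin θ • y) * fderiv ℝ u x y ∂stdGaussian E =
      ∫ y, -Real.sin θ * fderiv ℝ u (Real.cos θ • x - Real.sin θ • y)
        ((InnerProductSpace.toDual ℝ E).symm (fderiv ℝ u x)) ∂stdGaussian E := by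
    intro x
    set a := (InnerProductSpace.toDual ℝ E).symm (fderiv ℝ u x) with ha
    have hd : ∀ y, HasFDerivAt (fun y => u (Real.cos θ • x - Real.sin θ • y))
        ((fderiv ℝ u (Real.cos θ • x - Real.sin θ • y)).comp
          (-(Real.sin θ • ContinuousLinearMap.id ℝ E))) y := fun y =>
      (hu.differentiable _).hasFDerivAt.comp y
        (((hasFDerivAt_id y).const_smul (Real.sin θ)).const_sub (Real.cos θ • x))
    have hinner : ∀ y, fderiv ℝ u x y = inner ℝ a y := fun y => by
      simp [ha]
    have hbd : ∀ y, ‖u (Real.cos θ • x - Real.sin θ • y)‖ ≤ M := fun y => hM _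
    have hf : ∀ y, fderiv ℝ (fun y => u (Real.cos θ • x - Real.sin θ • y)) y a =
        -Real.sin θ * fderiv ℝ u (Real.cos θ • x - Real.sin θ • y) a := fun y => by
      rw [(hd y).fderiv]; simp
    simp_rw [hinner, ← hf]
    have hI : Integrable (fun y : E => inner ℝ a y) (stdGaussian E) :=
      (IsGaussian.integrable_id (μ := stdGaussian E)).const_inner a
    refine integral_mul_inner_stdGaussian (fun y => (hd y).differentiableAt) ?_ ?_ ?_
    · exact Integrable.of_bound (Continuous.aestronglyMeasurable (by fun_prop)) M (.of_forall hbd)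
    · exact hI.bdd_mul (Continuous.aestronglyMeasurable (by fun_prop)) (.of_forall hbd)
    · simp_rw [hf]
      refine Integrable.of_bound (Continuous.aestronglyMeasurable (by fun_prop))
        (|Real.sin θ| * (C * ‖a‖)) (.of_forall fun y => ?_)
      rw [norm_mul, norm_neg]
      refine mul_le_mul_of_nonneg_left ?_ (abs_nonneg _)
      exact (ContinuousLinearMap.le_opNorm _ _).trans
        (mul_le_mul_of_nonneg_right (hC _) (norm_nonneg _))
  rw [integral_prod _ hint]
  simp_rw [hstein]
  have hsq : Integrable (fun x => ‖fderiv ℝ u x‖ ^ 2) (stdGaussian E) := by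
    refine Integrable.of_bound (Continuous.aestronglyMeasurable (by fun_prop)) (C ^ 2)
      (.of_forall fun x => ?_)
    rw [norm_pow, norm_norm]
    exact pow_le_pow_left₀ (norm_nonneg _) (hC x) 2
  have ht : Continuous fun x => (InnerProductSpace.toDual ℝ E).symm (fderiv ℝ u x) :=
    (InnerProductSpace.toDual ℝ E).symm.continuous.comp hcu'
  have hnt : ∀ x, ‖(InnerProductSpace.toDual ℝ E).symm (fderiv ℝ u x)‖ = ‖fderiv ℝ u x‖ :=
    fun x => LinearIsometryEquiv.norm_map _ _
  have hint2 : Integrable (fun p : E × E => -Real.sin θ *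
      fderiv ℝ u (Real.cos θ • p.1 - Real.sin θ • p.2)
        ((InnerProductSpace.toDual ℝ E).symm (fderiv ℝ u p.1)))
      ((stdGaussian E).prod (stdGaussian E)) := by
    refine Integrable.of_bound (Continuous.aestronglyMeasurable (by fun_prop))
      (|Real.sin θ| * (C * C)) (.of_forall fun p => ?_)
    rw [norm_mul, norm_neg]
    refine mul_le_mul_of_nonneg_left ?_ (abs_nonneg _)
    refine (ContinuousLinearMap.le_opNorm _ _).trans ?_
    rw [hnt]
    exact mul_le_mul (hC _) (hC _) (norm_nonneg _) hC0
  rw [← integral_prod (fun p : E × E => -Real.sin θ *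
      fderiv ℝ u (Real.cos θ • p.1 - Real.sin θ • p.2)
        ((InnerProductSpace.toDual ℝ E).symm (fderiv ℝ u p.1))) hint2]
  have hB : Integrable (fun p : E × E => ‖fderiv ℝ u (Real.cos θ • p.1 - Real.sin θ • p.2)‖ ^ 2)
      ((stdGaussian E).prod (stdGaussian E)) := by
    refine Integrable.of_bound (Continuous.aestronglyMeasurable (by fun_prop)) (C ^ 2)
      (.of_forall fun x => ?_)
    rw [norm_pow, norm_norm]
    exact pow_le_pow_left₀ (norm_nonneg _) (hC _) 2
  have e1 : ∫ p : E × E, ‖fderiv ℝ u p.1‖ ^ 2 ∂(stdGaussian E).prod (stdGaussian E) =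
      ∫ x, ‖fderiv ℝ u x‖ ^ 2 ∂stdGaussian E := by
    rw [integral_fun_fst (fun x => ‖fderiv ℝ u x‖ ^ 2)]; simp
  have e2 : ∫ p : E × E, ‖fderiv ℝ u (Real.cos θ • p.1 - Real.sin θ • p.2)‖ ^ 2
      ∂(stdGaussian E).prod (stdGaussian E) = ∫ x, ‖fderiv ℝ u x‖ ^ 2 ∂stdGaussian E := by
    rw [← integral_rotation_stdGaussian θ (by fun_prop)]
    simp only [hsimp]
    exact e1
  calc -Real.sin θ * ∫ x, ‖fderiv ℝ u x‖ ^ 2 ∂stdGaussian E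
      = ∫ p : E × E, -Real.sin θ * ((‖fderiv ℝ u (Real.cos θ • p.1 - Real.sin θ • p.2)‖ ^ 2
          + ‖fderiv ℝ u p.1‖ ^ 2) / 2) ∂(stdGaussian E).prod (stdGaussian E) := by
        rw [integral_const_mul, integral_div, integral_add hB (hsq.comp_fst _), e1, e2]
        ring
    _ ≤ _ := by
        refine integral_mono (((hB.add (hsq.comp_fst _)).div_const 2).const_mul _) hint2
          fun p => ?_
        simp only [neg_mul]
        refine neg_le_neg (mul_le_mul_of_nonneg_left ?_ hθ)
        refine (le_abs_self _).trans ?_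
        rw [← Real.norm_eq_abs]
        refine (ContinuousLinearMap.le_opNorm _ _).trans ?_
        rw [hnt]
        nlinarith [sq_nonneg (‖fderiv ℝ u (Real.cos θ • p.1 - Real.sin θ • p.2)‖
          - ‖fderiv ℝ u p.1‖)]

/-- The **Gaussian Poincaré inequality** for smooth functions with compact support. -/
theorem IsTestFun.poincare {u : E → ℝ} (hu : IsTestFun u) :
    ∫ x, u x ^ 2 ∂stdGaussian E - (∫ x, u x ∂stdGaussian E) ^ 2 ≤
      ∫ x, ‖fderiv ℝ u x‖ ^ 2 ∂stdGaussian E := by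
  set A := ∫ x, ‖fderiv ℝ u x‖ ^ 2 ∂stdGaussian E with hA
  have hd : ∀ θ, HasDerivAt (fun θ => gaussInterp u θ - A * Real.cos θ)
      (deriv (gaussInterp u) θ - A * -Real.sin θ) θ := fun θ =>
    (hu.hasDerivAt_gaussInterp θ).differentiableAt.hasDerivAt.sub
      ((Real.hasDerivAt_cos θ).const_mul A)
  -- `A * cos θ` has derivative `-A * sin θ`, the lower bound just proved; its drop from `0` to
  -- `π/2` is exactly `A`.
  have hmono : MonotoneOn (fun θ => gaussInterp u θ - A * Real.cos θ)
      (Set.Icc 0 (Real.pi / 2)) := by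
    refine monotoneOn_of_deriv_nonneg (convex_Icc _ _)
      (fun θ _ => (hd θ).continuousAt.continuousWithinAt)
      (fun θ _ => (hd θ).differentiableAt.differentiableWithinAt) fun θ hθ => ?_
    rw [interior_Icc] at hθ
    rw [(hd θ).deriv]
    have := hu.le_deriv_gaussInterp (Real.sin_nonneg_of_nonneg_of_le_pi hθ.1.le
      (by linarith [hθ.2, Real.pi_pos]))
    rw [← hA] at this
    linarith
  have hpi : (0 : ℝ) ≤ Real.pi / 2 := by positivity
  have h := hmono (Set.left_mem_Icc.2 hpi) (Set.right_mem_Icc.2 hpi) hpi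
  have h0 : gaussInterp u 0 = ∫ x, u x ^ 2 ∂stdGaussian E := by
    simp only [gaussInterp, Real.cos_zero, one_smul, Real.sin_zero, zero_smul, add_zero]
    rw [integral_fun_fst (fun x => u x * u x)]
    simp [sq]
  have h1 : gaussInterp u (Real.pi / 2) = (∫ x, u x ∂stdGaussian E) ^ 2 := by
    simp only [gaussInterp, Real.cos_pi_div_two, one_smul, Real.sin_pi_div_two, zero_smul,
      zero_add]
    rw [integral_prod_mul, sq]
  simp only [h0, h1, Real.cos_zero, Real.cos_pi_div_two] at h
  linarith

end TestFunction

/-! ### The second order Stein identity. -/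

section SecondOrderStein

open scoped ContDiff

lemma IsTestFun.mul_inner_sub_fderiv {E : Type*} [NormedAddCommGroup E] [InnerProductSpace ℝ E]
    {u : E → ℝ} (hu : IsTestFun u) (a : E) :
    IsTestFun fun x => u x * inner ℝ a x - fderiv ℝ u x a :=
  (hu.mul (contDiff_const.inner ℝ contDiff_id)).sub (hu.fderiv_apply a)

lemma IsTestFun.fderiv_fderiv_comm {E : Type*} [NormedAddCommGroup E] [InnerProductSpace ℝ E]
    {u : E → ℝ} (hu : IsTestFun u) (a b x : E) :
    fderiv ℝ (fun y => fderiv ℝ u y a) x b = fderiv ℝ (fun y => fderiv ℝ u y b) x a := by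
  have hd : DifferentiableAt ℝ (fderiv ℝ u) x :=
    (hu.contDiff.fderiv_right (m := ∞) (by simp)).differentiable (by simp) x
  have h : ∀ c, fderiv ℝ (fun y => fderiv ℝ u y c) x = (fderiv ℝ (fderiv ℝ u) x).flip c :=
    fun c => by
      rw [fderiv_clm_apply hd (differentiableAt_const c)]
      simp
  rw [h, h]
  exact (hu.contDiff.contDiffAt.isSymmSndFDerivAt (by
    simpa using WithTop.coe_le_coe.2 (le_top : (2 : ℕ∞) ≤ ⊤))) b a

variable {ι : Type*} [Fintype ι] [DecidableEq ι]

/-- The squared Hilbert–Schmidt norm of an endomorphism of a Euclidean space. -/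
noncomputable def hsSq (L : EuclideanSpace ℝ ι →L[ℝ] EuclideanSpace ℝ ι) : ℝ :=
  ∑ i, ‖L (EuclideanSpace.single i 1)‖ ^ 2

/-- The trace of an endomorphism of a Euclidean space. -/
noncomputable def euclTrace (L : EuclideanSpace ℝ ι →L[ℝ] EuclideanSpace ℝ ι) : ℝ :=
  ∑ i, L (EuclideanSpace.single i 1) i

lemma continuous_hsSq : Continuous (hsSq : (EuclideanSpace ℝ ι →L[ℝ] EuclideanSpace ℝ ι) → ℝ) := by
  unfold hsSq; fun_prop

lemma continuous_euclTrace :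
    Continuous (euclTrace : (EuclideanSpace ℝ ι →L[ℝ] EuclideanSpace ℝ ι) → ℝ) := by
  unfold euclTrace
  refine continuous_finsetSum _ fun i _ => ?_
  exact (EuclideanSpace.proj (𝕜 := ℝ) i).continuous.comp (continuous_id.clm_apply continuous_const)

lemma hsSq_nonneg (L : EuclideanSpace ℝ ι →L[ℝ] EuclideanSpace ℝ ι) : 0 ≤ hsSq L :=
  Finset.sum_nonneg fun _ _ => sq_nonneg _

lemma hsSq_eq_sum (L : EuclideanSpace ℝ ι →L[ℝ] EuclideanSpace ℝ ι) :
    hsSq L = ∑ i, ∑ j, (L (EuclideanSpace.single i 1) j) ^ 2 := by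
  simp [hsSq, EuclideanSpace.real_norm_sq_eq]

lemma hsSq_le (L : EuclideanSpace ℝ ι →L[ℝ] EuclideanSpace ℝ ι) :
    hsSq L ≤ Fintype.card ι * ‖L‖ ^ 2 := by
  have : ∀ i ∈ (Finset.univ : Finset ι), ‖L (EuclideanSpace.single i 1)‖ ^ 2 ≤ ‖L‖ ^ 2 :=
    fun i _ => pow_le_pow_left₀ (norm_nonneg _) (by
      simpa using L.le_opNorm (EuclideanSpace.single i 1)) 2
  simpa [hsSq] using Finset.sum_le_card_nsmul _ _ _ this

lemma abs_euclTrace_le (L : EuclideanSpace ℝ ι →L[ℝ] EuclideanSpace ℝ ι) :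
    |euclTrace L| ≤ Fintype.card ι * ‖L‖ := by
  have : ∀ i ∈ (Finset.univ : Finset ι), |L (EuclideanSpace.single i 1) i| ≤ ‖L‖ := fun i _ => by
    have h1 := PiLp.norm_apply_le (p := 2) (L (EuclideanSpace.single i 1)) i
    have h2 := L.le_opNorm (EuclideanSpace.single i 1)
    simp only [PiLp.norm_single, norm_one, mul_one, Real.norm_eq_abs] at h1 h2
    exact h1.trans h2
  refine (Finset.abs_sum_le_sum_abs _ _).trans ?_
  simpa using Finset.sum_le_card_nsmul _ _ _ this

lemma norm_sq_le_hsSq (L : EuclideanSpace ℝ ι →L[ℝ] EuclideanSpace ℝ ι) : ‖L‖ ^ 2 ≤ hsSq L := by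
  have hL : ‖L‖ ≤ √(hsSq L) := by
    refine L.opNorm_le_bound (Real.sqrt_nonneg _) fun x => ?_
    have hx : x = ∑ i, x i • EuclideanSpace.single i (1 : ℝ) := by
      ext j
      simp [Finset.sum_apply, Pi.single_apply]
    have h1 : ‖L x‖ ≤ ∑ i, |x i| * ‖L (EuclideanSpace.single i 1)‖ := by
      conv_lhs => rw [hx]
      rw [map_sum]
      refine (norm_sum_le _ _).trans_eq ?_
      simp [norm_smul]
    refine h1.trans ((Real.sum_mul_le_sqrt_mul_sqrt _ _ _).trans_eq ?_)
    rw [mul_comm, EuclideanSpace.norm_eq]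
    simp [hsSq]
  calc ‖L‖ ^ 2 ≤ √(hsSq L) ^ 2 := pow_le_pow_left₀ (norm_nonneg _) hL 2
    _ = hsSq L := Real.sq_sqrt (hsSq_nonneg L)

lemma euclTrace_smul (c : ℝ) (L : EuclideanSpace ℝ ι →L[ℝ] EuclideanSpace ℝ ι) :
    euclTrace (c • L) = c * euclTrace L := by
  simp [euclTrace, Finset.mul_sum]

lemma hsSq_smul (c : ℝ) (L : EuclideanSpace ℝ ι →L[ℝ] EuclideanSpace ℝ ι) :
    hsSq (c • L) = c ^ 2 * hsSq L := by
  simp [hsSq, Finset.mul_sum, norm_smul, mul_pow]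

/-- The Gaussian divergence `⟨g, x⟩ - div g` of a vector field with components `g i`. -/
noncomputable def gaussDiv (g : ι → EuclideanSpace ℝ ι → ℝ) (x : EuclideanSpace ℝ ι) : ℝ :=
  ∑ i, (g i x * inner ℝ (EuclideanSpace.single i 1) x -
    fderiv ℝ (g i) x (EuclideanSpace.single i 1))

variable {g : ι → EuclideanSpace ℝ ι → ℝ}

lemma IsTestFun.gaussDiv (hg : ∀ i, IsTestFun (g i)) : IsTestFun (gaussDiv g) :=
  IsTestFun.sum fun i => (hg i).mul_inner_sub_fderiv _

/-- The commutator of ∂_j with the Gaussian divergence: differentiating the factor ⟨e_i, x⟩ produces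
the extra `g j x`, and symmetry of second derivatives makes the rest the divergence of ∂_j g. -/
lemma fderiv_gaussDiv (hg : ∀ i, IsTestFun (g i)) (j : ι) (x : EuclideanSpace ℝ ι) :
    fderiv ℝ (gaussDiv g) x (EuclideanSpace.single j 1) =
      g j x + ∑ i, (fderiv ℝ (g i) x (EuclideanSpace.single j 1) *
        inner ℝ (EuclideanSpace.single i 1) x -
        fderiv ℝ (fun y => fderiv ℝ (g i) y (EuclideanSpace.single j 1)) x
          (EuclideanSpace.single i 1)) := by
  have hi : ∀ i, HasFDerivAt (fun y : EuclideanSpace ℝ ι => inner ℝ (EuclideanSpace.single i 1) y)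
      (innerSL ℝ (EuclideanSpace.single i (1 : ℝ))) x := fun i =>
    (innerSL ℝ (EuclideanSpace.single i (1 : ℝ))).hasFDerivAt
  have h : ∀ i, HasFDerivAt (fun y => g i y * inner ℝ (EuclideanSpace.single i 1) y -
      fderiv ℝ (g i) y (EuclideanSpace.single i 1)) _ x := fun i =>
    (((hg i).differentiable x).hasFDerivAt.mul (hi i)).sub
      (((hg i).fderiv_apply (EuclideanSpace.single i 1)).differentiable x).hasFDerivAt
  have hs := HasFDerivAt.fun_sum (u := Finset.univ) fun i _ => h i
  have e : fderiv ℝ (gaussDiv g) x = _ := hs.fderiv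
  rw [e]
  simp only [sum_apply, sub_apply, add_apply, smul_apply, smul_eq_mul,
    innerSL_apply_apply, (hg _).fderiv_fderiv_comm _ (EuclideanSpace.single j 1) x,
    EuclideanSpace.inner_single_left]
  have : g j x = ∑ i, g i x * (EuclideanSpace.single j (1 : ℝ) i : ℝ) := by
    simp [PiLp.single_apply]
  rw [this, ← Finset.sum_add_distrib]
  refine Finset.sum_congr rfl fun i _ => ?_
  simp
  ring

/-- The **second order Stein identity** for smooth vector fields with compact support. -/
theorem integral_gaussDiv_sq (hg : ∀ i, IsTestFun (g i)) :
    ∫ x, gaussDiv g x ^ 2 ∂stdGaussian (EuclideanSpace ℝ ι) =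
      ∫ x, ∑ j, (g j x ^ 2 + ∑ i, fderiv ℝ (g j) x (EuclideanSpace.single i 1) *
        fderiv ℝ (g i) x (EuclideanSpace.single j 1)) ∂stdGaussian (EuclideanSpace ℝ ι) := by
  have hD := IsTestFun.gaussDiv hg
  have hd := fun i j => (hg i).fderiv_apply (EuclideanSpace.single j 1)
  have e1 : ∀ x, gaussDiv g x ^ 2 = ∑ j, gaussDiv g x *
      (g j x * inner ℝ (EuclideanSpace.single j 1) x -
        fderiv ℝ (g j) x (EuclideanSpace.single j 1)) := fun x => by
    rw [sq, ← Finset.mul_sum]; rfl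
  have i1 : ∀ j, Integrable (fun x => g j x ^ 2) (stdGaussian (EuclideanSpace ℝ ι)) := fun j => by
    simpa only [sq] using ((hg j).mul (hg j).contDiff).integrable
  have i2 : ∀ i j, Integrable (fun x => fderiv ℝ (g j) x (EuclideanSpace.single i 1) *
        fderiv ℝ (g i) x (EuclideanSpace.single j 1)) (stdGaussian (EuclideanSpace ℝ ι)) :=
    fun i j => ((hd j i).mul (hd i j).contDiff).integrable
  have i3 : ∀ i j, Integrable (fun x => g j x * (fderiv ℝ (g i) x (EuclideanSpace.single j 1) *
        inner ℝ (EuclideanSpace.single i 1) x -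
        fderiv ℝ (fun y => fderiv ℝ (g i) y (EuclideanSpace.single j 1)) x
          (EuclideanSpace.single i 1))) (stdGaussian (EuclideanSpace ℝ ι)) := fun i j =>
    ((hg j).mul ((hd i j).mul_inner_sub_fderiv _).contDiff).integrable
  have i4 : ∀ j, Integrable (fun x => g j x ^ 2 + ∑ i, fderiv ℝ (g j) x
      (EuclideanSpace.single i 1) * fderiv ℝ (g i) x (EuclideanSpace.single j 1))
      (stdGaussian (EuclideanSpace ℝ ι)) := fun j =>
    (i1 j).add (integrable_finsetSum _ fun i _ => i2 i j)
  simp_rw [e1]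
  rw [integral_finsetSum _ fun j _ => (hD.mul ((hg j).mul_inner_sub_fderiv _).contDiff).integrable,
    integral_finsetSum _ fun j _ => i4 j]
  refine Finset.sum_congr rfl fun j _ => ?_
  -- Adjointness is used twice: here it puts ∂_j on the divergence, and after commuting it turns
  -- each remaining term into a product of first derivatives.
  rw [hD.integral_mul_adjoint (hg j), integral_add (i1 j) (integrable_finsetSum _ fun i _ => i2 i j),
    integral_finsetSum _ fun i _ => i2 i j]
  have e2 : ∀ x, fderiv ℝ (gaussDiv g) x (EuclideanSpace.single j 1) * g j x = g j x ^ 2 +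
      ∑ i, g j x * (fderiv ℝ (g i) x (EuclideanSpace.single j 1) *
        inner ℝ (EuclideanSpace.single i 1) x -
        fderiv ℝ (fun y => fderiv ℝ (g i) y (EuclideanSpace.single j 1)) x
          (EuclideanSpace.single i 1)) := fun x => by
    rw [fderiv_gaussDiv hg, ← Finset.mul_sum]; ring
  simp_rw [e2]
  rw [integral_add (i1 j) (integrable_finsetSum _ fun i _ => i3 i j),
    integral_finsetSum _ fun i _ => i3 i j]
  congr 1
  exact Finset.sum_congr rfl fun i _ => (hg j).integral_mul_adjoint (hd i j) _

end SecondOrderStein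

/-! ### The two Gaussian inequalities for vector fields, and their stability. -/

section SteinPoincare

open scoped ContDiff Topology
open Filter

variable {ι : Type*} [Fintype ι] [DecidableEq ι]

/-- The Gaussian Poincaré inequality and the second order Stein inequality for a vector field `g`
with (weak) derivative `g'`. -/
structure SteinPoincare (g : EuclideanSpace ℝ ι → EuclideanSpace ℝ ι)
    (g' : EuclideanSpace ℝ ι → EuclideanSpace ℝ ι →L[ℝ] EuclideanSpace ℝ ι) : Prop where
  poincare : ∫ x, ‖g x - ∫ y, g y ∂stdGaussian (EuclideanSpace ℝ ι)‖ ^ 2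
      ∂stdGaussian (EuclideanSpace ℝ ι) ≤ ∫ x, hsSq (g' x) ∂stdGaussian (EuclideanSpace ℝ ι)
  stein : ∫ x, (inner ℝ (g x) x - euclTrace (g' x)) ^ 2 ∂stdGaussian (EuclideanSpace ℝ ι) ≤
    ∫ x, ‖g x‖ ^ 2 ∂stdGaussian (EuclideanSpace ℝ ι) +
      ∫ x, hsSq (g' x) ∂stdGaussian (EuclideanSpace ℝ ι)

/-- The Poincaré half is the scalar inequality summed over components. The Stein half follows from
the identity because tr(A²) is at most the squared Hilbert–Schmidt norm of A. -/
theorem SteinPoincare.of_smooth {g : EuclideanSpace ℝ ι → EuclideanSpace ℝ ι}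
    (hg : ContDiff ℝ ∞ g) (hc : HasCompactSupport g) : SteinPoincare g (fderiv ℝ g) := by
  have hi : ∀ i, IsTestFun fun x => g x i := fun i =>
    ⟨(EuclideanSpace.proj (𝕜 := ℝ) i).contDiff.comp hg, hc.comp_left (g := fun y : EuclideanSpace ℝ ι => y i) rfl⟩
  have hd : ∀ i x a, fderiv ℝ (fun x => g x i) x a = fderiv ℝ g x a i := fun i x a => by
    have := ((EuclideanSpace.proj (𝕜 := ℝ) i).hasFDerivAt.comp x
      (hg.differentiable (by simp) x).hasFDerivAt).fderiv
    change fderiv ℝ ((EuclideanSpace.proj (𝕜 := ℝ) i) ∘ g) x a = _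
    rw [this]; rfl
  have hgi : Integrable g (stdGaussian (EuclideanSpace ℝ ι)) :=
    hg.continuous.integrable_of_hasCompactSupport hc
  have hm : ∀ i, (∫ y, g y ∂stdGaussian (EuclideanSpace ℝ ι)) i =
      ∫ y, g y i ∂stdGaussian (EuclideanSpace ℝ ι) := fun i =>
    ((EuclideanSpace.proj (𝕜 := ℝ) i).integral_comp_comm hgi).symm
  have hsq : ∀ i, Integrable (fun x => g x i ^ 2) (stdGaussian (EuclideanSpace ℝ ι)) := fun i => by
    simpa only [sq] using ((hi i).mul (hi i).contDiff).integrable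
  have hdd : ∀ i j k l, Integrable (fun x => fderiv ℝ g x (EuclideanSpace.single i 1) j *
      fderiv ℝ g x (EuclideanSpace.single k 1) l) (stdGaussian (EuclideanSpace ℝ ι)) :=
    fun i j k l => by
      simpa only [hd] using (((hi j).fderiv_apply (EuclideanSpace.single i 1)).mul
        ((hi l).fderiv_apply (EuclideanSpace.single k 1)).contDiff).integrable
  have hhs : ∫ x, hsSq (fderiv ℝ g x) ∂stdGaussian (EuclideanSpace ℝ ι) =
      ∑ i, ∑ j, ∫ x, (fderiv ℝ g x (EuclideanSpace.single i 1) j) ^ 2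
        ∂stdGaussian (EuclideanSpace ℝ ι) := by
    simp_rw [hsSq_eq_sum, sq]
    rw [integral_finsetSum _ fun i _ => integrable_finsetSum _ fun j _ => hdd i j i j]
    exact Finset.sum_congr rfl fun i _ => integral_finsetSum _ fun j _ => hdd i j i j
  constructor
  · have h1 : ∀ j, ∫ x, (g x j - ∫ y, g y j ∂stdGaussian (EuclideanSpace ℝ ι)) ^ 2
        ∂stdGaussian (EuclideanSpace ℝ ι) ≤
        ∑ i, ∫ x, (fderiv ℝ g x (EuclideanSpace.single i 1) j) ^ 2
          ∂stdGaussian (EuclideanSpace ℝ ι) := by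
      intro j
      set m := ∫ y, g y j ∂stdGaussian (EuclideanSpace ℝ ι) with hmdef
      have e : ∀ x, (g x j - m) ^ 2 = g x j ^ 2 - 2 * m * g x j + m ^ 2 := fun x => by ring
      have hp := (hi j).poincare
      have hn : ∀ x, ‖fderiv ℝ (fun x => g x j) x‖ ^ 2 =
          ∑ i, (fderiv ℝ g x (EuclideanSpace.single i 1) j) ^ 2 := fun x => by
        rw [(EuclideanSpace.basisFun ι ℝ).norm_dual]
        simp [hd]
      simp_rw [hn] at hp
      rw [integral_finsetSum _ fun i _ => by simpa only [sq] using hdd i j i j] at hp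
      have hl : Integrable (fun x => g x j ^ 2 - 2 * m * g x j)
          (stdGaussian (EuclideanSpace ℝ ι)) := (hsq j).sub ((hi j).integrable.const_mul _)
      simp_rw [e]
      rw [integral_add hl (integrable_const _), integral_sub (hsq j) ((hi j).integrable.const_mul _), integral_const_mul, ← hmdef]
      rw [← hmdef] at hp
      simp only [integral_const, probReal_univ, smul_eq_mul, one_mul]
      linarith
    have h2 : ∀ j, Integrable (fun x => (g x j - ∫ y, g y j ∂stdGaussian (EuclideanSpace ℝ ι)) ^ 2)
        (stdGaussian (EuclideanSpace ℝ ι)) := fun j => by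
      simp_rw [sub_sq]
      exact ((hsq j).sub (((hi j).integrable.const_mul 2).mul_const _)).add (integrable_const _)
    simp_rw [EuclideanSpace.real_norm_sq_eq, PiLp.sub_apply, hm]
    rw [integral_finsetSum _ fun j _ => h2 j, hhs, Finset.sum_comm]
    exact Finset.sum_le_sum fun j _ => h1 j
  · have key := integral_gaussDiv_sq hi
    have e : ∀ x, gaussDiv (fun i x => g x i) x =
        inner ℝ (g x) x - euclTrace (fderiv ℝ g x) := fun x => by
      simp [gaussDiv, euclTrace, hd, PiLp.inner_apply, mul_comm]
    simp_rw [e, hd] at key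
    rw [key, hhs]
    simp_rw [EuclideanSpace.real_norm_sq_eq]
    have h5 : ∀ j, Integrable (fun x => g x j ^ 2 + ∑ i, fderiv ℝ g x (EuclideanSpace.single i 1) j *
        fderiv ℝ g x (EuclideanSpace.single j 1) i) (stdGaussian (EuclideanSpace ℝ ι)) := fun j =>
      (hsq j).add (integrable_finsetSum _ fun i _ => hdd i j j i)
    rw [integral_finsetSum _ fun j _ => hsq j, integral_finsetSum _ fun j _ => h5 j]
    have h3 : ∀ j, ∫ x, (g x j ^ 2 + ∑ i, fderiv ℝ g x (EuclideanSpace.single i 1) j *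
        fderiv ℝ g x (EuclideanSpace.single j 1) i) ∂stdGaussian (EuclideanSpace ℝ ι) =
        ∫ x, g x j ^ 2 ∂stdGaussian (EuclideanSpace ℝ ι) +
        ∑ i, ∫ x, fderiv ℝ g x (EuclideanSpace.single i 1) j *
          fderiv ℝ g x (EuclideanSpace.single j 1) i ∂stdGaussian (EuclideanSpace ℝ ι) :=
      fun j => by
        rw [integral_add (hsq j) (integrable_finsetSum _ fun i _ => hdd i j j i),
          integral_finsetSum _ fun i _ => hdd i j j i]
    simp_rw [h3]
    rw [Finset.sum_add_distrib]
    refine add_le_add le_rfl ?_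
    have h4 : ∀ i j, ∫ x, fderiv ℝ g x (EuclideanSpace.single i 1) j *
          fderiv ℝ g x (EuclideanSpace.single j 1) i ∂stdGaussian (EuclideanSpace ℝ ι) ≤
        (∫ x, (fderiv ℝ g x (EuclideanSpace.single i 1) j) ^ 2 ∂stdGaussian (EuclideanSpace ℝ ι) +
        ∫ x, (fderiv ℝ g x (EuclideanSpace.single j 1) i) ^ 2 ∂stdGaussian (EuclideanSpace ℝ ι)) / 2
        := fun i j => by
      have s1 : Integrable (fun x => (fderiv ℝ g x (EuclideanSpace.single i 1) j) ^ 2)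
          (stdGaussian (EuclideanSpace ℝ ι)) := by simpa only [sq] using hdd i j i j
      have s2 : Integrable (fun x => (fderiv ℝ g x (EuclideanSpace.single j 1) i) ^ 2)
          (stdGaussian (EuclideanSpace ℝ ι)) := by simpa only [sq] using hdd j i j i
      rw [← integral_add s1 s2, ← integral_div]
      refine integral_mono (hdd i j j i) ((s1.add s2).div_const 2) fun x => ?_
      dsimp only
      linarith [two_mul_le_add_sq (fderiv ℝ g x (EuclideanSpace.single i 1) j)
        (fderiv ℝ g x (EuclideanSpace.single j 1) i)]
    refine (Finset.sum_le_sum fun j _ => Finset.sum_le_sum fun i _ => h4 i j).trans_eq ?_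
    simp_rw [← Finset.sum_div, Finset.sum_add_distrib]
    rw [Finset.sum_comm]
    ring

/-- The inequalities pass to limits that are dominated in the Gaussian `L²` sense. -/
theorem SteinPoincare.of_tendsto {G : ℕ → EuclideanSpace ℝ ι → EuclideanSpace ℝ ι}
    {G' : ℕ → EuclideanSpace ℝ ι → EuclideanSpace ℝ ι →L[ℝ] EuclideanSpace ℝ ι}
    {g : EuclideanSpace ℝ ι → EuclideanSpace ℝ ι}
    {g' : EuclideanSpace ℝ ι → EuclideanSpace ℝ ι →L[ℝ] EuclideanSpace ℝ ι}
    {M : ℝ} {w : EuclideanSpace ℝ ι → ℝ} (h : ∀ k, SteinPoincare (G k) (G' k))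
    (hG : ∀ k, AEStronglyMeasurable (G k) (stdGaussian (EuclideanSpace ℝ ι)))
    (hG' : ∀ k, AEStronglyMeasurable (G' k) (stdGaussian (EuclideanSpace ℝ ι)))
    (hM : ∀ k, ∀ᵐ x ∂stdGaussian (EuclideanSpace ℝ ι), ‖G k x‖ ≤ M)
    (hw : ∀ k, ∀ᵐ x ∂stdGaussian (EuclideanSpace ℝ ι), ‖G' k x‖ ≤ w x)
    (hwi : Integrable (fun x => w x ^ 2) (stdGaussian (EuclideanSpace ℝ ι)))
    (hlim : ∀ᵐ x ∂stdGaussian (EuclideanSpace ℝ ι), Tendsto (fun k => G k x) atTop (𝓝 (g x)))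
    (hlim' : ∀ᵐ x ∂stdGaussian (EuclideanSpace ℝ ι), Tendsto (fun k => G' k x) atTop (𝓝 (g' x))) :
    SteinPoincare g g' := by
  set γ := stdGaussian (EuclideanSpace ℝ ι) with hγ
  have hmean : Tendsto (fun k => ∫ y, G k y ∂γ) atTop (𝓝 (∫ y, g y ∂γ)) :=
    tendsto_integral_of_dominated_convergence (fun _ => M) hG (integrable_const _) hM hlim
  have hmeanle : ∀ k, ‖∫ y, G k y ∂γ‖ ≤ M := fun k => by
    simpa using norm_integral_le_of_norm_le_const (hM k)
  have hhs : Tendsto (fun k => ∫ x, hsSq (G' k x) ∂γ) atTop (𝓝 (∫ x, hsSq (g' x) ∂γ)) := by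
    refine tendsto_integral_of_dominated_convergence (fun x => Fintype.card ι * w x ^ 2)
      (fun k => continuous_hsSq.comp_aestronglyMeasurable (hG' k)) (hwi.const_mul _) (fun k => ?_)
      (hlim'.mono fun x hx => (continuous_hsSq.tendsto _).comp hx)
    filter_upwards [hw k] with x hx
    rw [Real.norm_of_nonneg (hsSq_nonneg _)]
    refine (hsSq_le _).trans ?_
    gcongr
  have hnorm : Tendsto (fun k => ∫ x, ‖G k x‖ ^ 2 ∂γ) atTop (𝓝 (∫ x, ‖g x‖ ^ 2 ∂γ)) := by
    refine tendsto_integral_of_dominated_convergence (fun _ => M ^ 2)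
      (fun k => (hG k).norm.pow 2) (integrable_const _) (fun k => ?_)
      (hlim.mono fun x hx => hx.norm.pow 2)
    filter_upwards [hM k] with x hx
    rw [norm_pow, norm_norm]
    gcongr
  have hvar : Tendsto (fun k => ∫ x, ‖G k x - ∫ y, G k y ∂γ‖ ^ 2 ∂γ) atTop
      (𝓝 (∫ x, ‖g x - ∫ y, g y ∂γ‖ ^ 2 ∂γ)) := by
    refine tendsto_integral_of_dominated_convergence (fun _ => (M + M) ^ 2)
      (fun k => ((hG k).sub aestronglyMeasurable_const).norm.pow 2) (integrable_const _)
      (fun k => ?_) (hlim.mono fun x hx => (hx.sub hmean).norm.pow 2)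
    filter_upwards [hM k] with x hx
    rw [norm_pow, norm_norm]
    gcongr
    exact (norm_sub_le _ _).trans (add_le_add hx (hmeanle k))
  have hstein : Tendsto (fun k => ∫ x, (inner ℝ (G k x) x - euclTrace (G' k x)) ^ 2 ∂γ) atTop
      (𝓝 (∫ x, (inner ℝ (g x) x - euclTrace (g' x)) ^ 2 ∂γ)) := by
    refine tendsto_integral_of_dominated_convergence
      -- From (a - b)² ≤ 2a² + 2b², Cauchy–Schwarz and |tr L| ≤ d‖L‖.
      (fun x => 2 * (M ^ 2 * ‖x‖ ^ 2) + 2 * ((Fintype.card ι : ℝ) ^ 2 * w x ^ 2))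
      (fun k => (((hG k).inner aestronglyMeasurable_id).sub
        (continuous_euclTrace.comp_aestronglyMeasurable (hG' k))).pow 2)
      ((((integrable_norm_pow_stdGaussian 2).const_mul _).const_mul _).add
        ((hwi.const_mul _).const_mul _)) (fun k => ?_) ?_
    · filter_upwards [hM k, hw k] with x hx hx'
      rw [norm_pow, Real.norm_eq_abs, sq_abs]
      have h1 : (inner ℝ (G k x) x) ^ 2 ≤ M ^ 2 * ‖x‖ ^ 2 := by
        rw [← mul_pow, ← sq_abs]
        gcongr
        exact (abs_real_inner_le_norm _ _).trans (by gcongr)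
      have h2 : (euclTrace (G' k x)) ^ 2 ≤ (Fintype.card ι : ℝ) ^ 2 * w x ^ 2 := by
        rw [← mul_pow, ← sq_abs]
        gcongr
        exact (abs_euclTrace_le _).trans (by gcongr)
      nlinarith [sq_nonneg (inner ℝ (G k x) x + euclTrace (G' k x))]
    · filter_upwards [hlim, hlim'] with x hx hx'
      exact ((hx.inner tendsto_const_nhds).sub
        ((continuous_euclTrace.tendsto _).comp hx')).pow 2
  exact ⟨le_of_tendsto_of_tendsto' hvar hhs fun k => (h k).poincare,
    le_of_tendsto_of_tendsto' hstein (hnorm.add hhs) fun k => (h k).stein⟩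

end SteinPoincare

/-! ### From smooth to Lipschitz fields. -/

section Mollification

open scoped ContDiff Topology
open Filter
open scoped Convolution

variable {E F : Type*} [NormedAddCommGroup E]

variable [NormedSpace ℝ E] in
/-- The bump functions at the origin supported in the ball of radius `2 / (k + 1)`. -/
noncomputable def shrinkingBump (k : ℕ) : ContDiffBump (0 : E) where
  rIn := 1 / (k + 1)
  rOut := 2 * (1 / (k + 1))
  rIn_pos := by positivity
  rIn_lt_rOut := by
    have : (0 : ℝ) < 1 / (k + 1) := by positivity
    linarith

lemma tendsto_shrinkingBump_rOut :
    Tendsto (fun k => (shrinkingBump (E := E) k).rOut) atTop (𝓝 0) := by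
  simpa [shrinkingBump] using (tendsto_one_div_add_atTop_nhds_zero_nat (𝕜 := ℝ)).const_mul 2

variable [InnerProductSpace ℝ E] [FiniteDimensional ℝ E] [MeasurableSpace E] [BorelSpace E]
  [NormedAddCommGroup F] [NormedSpace ℝ F]

/-- Convolving a Lipschitz map with an integrable kernel differentiates the map. -/
lemma hasFDerivAt_convolution_of_lipschitzWith [FiniteDimensional ℝ F]
    {K : NNReal} {φ : E → ℝ} (hφ : Integrable φ) {g : E → F} {M : ℝ} (hM : ∀ x, ‖g x‖ ≤ M)
    (hg : LipschitzWith K g) (x : E) :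
    HasFDerivAt (φ ⋆[ContinuousLinearMap.lsmul ℝ ℝ, volume] g)
      ((φ ⋆[ContinuousLinearMap.lsmul ℝ ℝ, volume] (fderiv ℝ g)) x) x := by
  borelize F
  have hmp : MeasurePreserving (fun t : E => x - t) volume volume :=
    volume.measurePreserving_sub_left x
  refine (hasFDerivAt_integral_of_dominated_loc_of_lip (μ := (volume : Measure E))
    (F := fun x t => φ t • g (x - t)) (F' := fun t => φ t • fderiv ℝ g (x - t))
    (bound := fun t => |φ t| * K) (s := Set.univ) univ_mem ?_ ?_ ?_ ?_ ?_ ?_).2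
  · refine .of_forall fun y => hφ.aestronglyMeasurable.smul ?_
    exact (hg.continuous.comp (continuous_const.sub continuous_id)).aestronglyMeasurable
  · exact hφ.smul_bdd M
      (hg.continuous.comp (continuous_const.sub continuous_id)).aestronglyMeasurable
      (.of_forall fun t => hM _)
  · refine hφ.aestronglyMeasurable.smul (Measurable.aestronglyMeasurable ?_)
    exact (measurable_fderiv ℝ g).comp (measurable_const.sub measurable_id)
  · refine .of_forall fun t => LipschitzOnWith.of_dist_le_mul fun y _ z _ => ?_
    rw [dist_eq_norm, ← smul_sub, norm_smul, Real.coe_nnabs, abs_mul, abs_abs, mul_assoc,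
      Real.norm_eq_abs, NNReal.abs_eq]
    gcongr
    have := hg.dist_le_mul (y - t) (z - t)
    rwa [dist_sub_right, dist_eq_norm] at this
  · exact hφ.abs.mul_const _
  -- Rademacher's theorem, transported by the measure-preserving map `t ↦ x - t`.
  · have : ∀ᵐ t, DifferentiableAt ℝ g (x - t) :=
      hmp.quasiMeasurePreserving.ae (hg.ae_differentiableAt (μ := (volume : Measure E)))
    filter_upwards [this] with t ht
    have h1 : HasFDerivAt (fun y => g (y - t)) (fderiv ℝ g (x - t)) x :=
      ht.hasFDerivAt.comp x ((hasFDerivAt_id x).sub_const t)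
    exact h1.const_smul (φ t)

/-- The convolution with the `k`-th shrinking bump function. -/
noncomputable def mollify (k : ℕ) (v : E → F) : E → F :=
  (shrinkingBump k).normed volume ⋆[ContinuousLinearMap.lsmul ℝ ℝ, volume] v

lemma norm_mollify_le (k : ℕ) {v : E → F} {C : ℝ} (hC : ∀ x, ‖v x‖ ≤ C) (x : E) :
    ‖mollify k v x‖ ≤ C := by
  calc ‖mollify k v x‖ ≤ ∫ t, (shrinkingBump (E := E) k).normed volume t * C := by
        refine norm_integral_le_of_norm_le ((shrinkingBump k).integrable_normed.mul_const C)
          (.of_forall fun t => ?_)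
        rw [ContinuousLinearMap.lsmul_apply, norm_smul,
          Real.norm_of_nonneg ((shrinkingBump k).nonneg_normed t)]
        exact mul_le_mul_of_nonneg_left (hC _) ((shrinkingBump k).nonneg_normed t)
    _ = C := by rw [integral_mul_const, (shrinkingBump k).integral_normed, one_mul]

lemma contDiff_mollify (k : ℕ) {v : E → F} (hv : Continuous v) : ContDiff ℝ ∞ (mollify k v) :=
  (shrinkingBump k).hasCompactSupport_normed.contDiff_convolution_left _
    (shrinkingBump k).contDiff_normed hv.locallyIntegrable

lemma hasCompactSupport_mollify (k : ℕ) {v : E → F} (hv : HasCompactSupport v) :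
    HasCompactSupport (mollify k v) :=
  (shrinkingBump k).hasCompactSupport_normed.convolution _ hv

lemma tendsto_mollify [CompleteSpace F] {v : E → F} (hv : Continuous v) (x : E) :
    Tendsto (fun k => mollify k v x) atTop (𝓝 (v x)) :=
  ContDiffBump.convolution_tendsto_right_of_continuous tendsto_shrinkingBump_rOut hv x

/-- Needed for the derivative of a Lipschitz map, which may be discontinuous. Lebesgue
differentiation applies because the ratio of outer to inner radius stays equal to 2. -/
lemma ae_tendsto_mollify [CompleteSpace F] {v : E → F} (hv : LocallyIntegrable v) :
    ∀ᵐ x, Tendsto (fun k => mollify k v x) atTop (𝓝 (v x)) :=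
  ContDiffBump.ae_convolution_tendsto_right_of_locallyIntegrable
    tendsto_shrinkingBump_rOut (K := 2) (.of_forall fun _ => le_rfl) hv

lemma fderiv_mollify [FiniteDimensional ℝ F] (k : ℕ) {K : NNReal} {v : E → F} {M : ℝ}
    (hM : ∀ x, ‖v x‖ ≤ M) (hv : LipschitzWith K v) (x : E) :
    fderiv ℝ (mollify k v) x = mollify k (fderiv ℝ v) x :=
  (hasFDerivAt_convolution_of_lipschitzWith (shrinkingBump k).integrable_normed hM hv x).fderiv

/-- The derivative of the mollified field is the mollified derivative, so it inherits the bound `K`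
and converges almost everywhere. -/
theorem SteinPoincare.of_lipschitz {ι : Type*} [Fintype ι] [DecidableEq ι]
    {g : EuclideanSpace ℝ ι → EuclideanSpace ℝ ι} {K : NNReal}
    (hg : LipschitzWith K g) (hc : HasCompactSupport g) : SteinPoincare g (fderiv ℝ g) := by
  obtain ⟨M, hM⟩ := hg.continuous.bounded_above_of_compact_support hc
  have hK : ∀ x, ‖fderiv ℝ g x‖ ≤ K := fun x => norm_fderiv_le_of_lipschitz ℝ hg
  have hli : LocallyIntegrable (fderiv ℝ g) (volume : Measure (EuclideanSpace ℝ ι)) :=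
    (locallyIntegrable_const (K : ℝ)).mono (measurable_fderiv ℝ g).aestronglyMeasurable
      (.of_forall fun x => by simpa using hK x)
  have hsm := fun k => contDiff_mollify k hg.continuous
  refine SteinPoincare.of_tendsto (M := M) (w := fun _ => (K : ℝ)) (G := fun k => mollify k g)
    (fun k => SteinPoincare.of_smooth (hsm k) (hasCompactSupport_mollify k hc))
    (fun k => (hsm k).continuous.aestronglyMeasurable)
    (fun k => ((hsm k).continuous_fderiv (by simp)).aestronglyMeasurable)
    (fun k => .of_forall fun x => norm_mollify_le k hM x)
    (fun k => .of_forall fun x => ?_) (integrable_const _)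
    (.of_forall fun x => tendsto_mollify hg.continuous x) ?_
  · rw [fderiv_mollify k hM hg]
    exact norm_mollify_le k hK x
  · refine stdGaussian_absolutelyContinuous.ae_le ?_
    filter_upwards [ae_tendsto_mollify hli] with x hx
    simpa only [fderiv_mollify _ hM hg] using hx

end Mollification

/-! ### Removing the origin: scale-invariant cutoffs. -/

section AnnularCutoff

open scoped ContDiff Topology
open Filter

variable {E F : Type*} [NormedAddCommGroup E]

/-- A smooth bump function on the line which is `1` on `[-1, 1]` and `0` off `(-2, 2)`. -/
noncomputable def lineBump : ContDiffBump (0 : ℝ) := ⟨1, 2, one_pos, one_lt_two⟩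

/-- A smooth cutoff to an annulus; these exhaust `E \ {0}` as `k` tends to infinity. -/
noncomputable def annularCutoff (k : ℕ) (x : E) : ℝ :=
  lineBump ((k + 1 : ℝ)⁻¹ * ‖x‖ ^ 2) - lineBump ((k + 1 : ℝ) * ‖x‖ ^ 2)

lemma annularCutoff_zero (k : ℕ) : annularCutoff k (0 : E) = 0 := by
  simp [annularCutoff]

lemma abs_annularCutoff_le_one (k : ℕ) (x : E) : |annularCutoff k x| ≤ 1 := by
  unfold annularCutoff
  rw [abs_le]
  constructor <;>
  linarith [lineBump.nonneg (x := (k + 1 : ℝ)⁻¹ * ‖x‖ ^ 2), lineBump.le_one (x := (k + 1 : ℝ)⁻¹ * ‖x‖ ^ 2),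
    lineBump.nonneg (x := (k + 1 : ℝ) * ‖x‖ ^ 2), lineBump.le_one (x := (k + 1 : ℝ) * ‖x‖ ^ 2)]

lemma eventually_annularCutoff_eq_one {x : E} (hx : x ≠ 0) :
    ∀ᶠ k : ℕ in atTop, ∀ᶠ y in 𝓝 x, annularCutoff k y = 1 := by
  have hx0 : 0 < ‖x‖ ^ 2 := by positivity
  have h1 : ∀ᶠ k : ℕ in atTop, ‖x‖ ^ 2 < k + 1 := by
    filter_upwards [(tendsto_natCast_atTop_atTop (R := ℝ)).eventually_gt_atTop (‖x‖ ^ 2)] with k hk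
    linarith
  have h2 : ∀ᶠ k : ℕ in atTop, 2 / ‖x‖ ^ 2 < k + 1 := by
    filter_upwards [(tendsto_natCast_atTop_atTop (R := ℝ)).eventually_gt_atTop (2 / ‖x‖ ^ 2)]
      with k hk
    linarith
  have hc : Continuous fun y : E => ‖y‖ ^ 2 := by fun_prop
  filter_upwards [h1, h2] with k hk1 hk2
  have hk0 : (0 : ℝ) < k + 1 := by positivity
  have h3 : ∀ᶠ y in 𝓝 x, ‖y‖ ^ 2 < k + 1 := hc.tendsto x |>.eventually_lt_const hk1
  have h4 : ∀ᶠ y in 𝓝 x, 2 / (k + 1 : ℝ) < ‖y‖ ^ 2 := by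
    refine hc.tendsto x |>.eventually_const_lt ?_
    rw [div_lt_iff₀ hk0]
    rw [div_lt_iff₀ hx0] at hk2
    linarith
  filter_upwards [h3, h4] with y hy1 hy2
  have e1 : lineBump ((k + 1 : ℝ)⁻¹ * ‖y‖ ^ 2) = 1 := by
    refine lineBump.one_of_mem_closedBall ?_
    rw [Metric.mem_closedBall, dist_zero_right, Real.norm_of_nonneg (by positivity)]
    change (k + 1 : ℝ)⁻¹ * ‖y‖ ^ 2 ≤ 1
    rw [inv_mul_le_iff₀ hk0]
    linarith
  have e2 : lineBump ((k + 1 : ℝ) * ‖y‖ ^ 2) = 0 := by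
    refine lineBump.zero_of_le_dist ?_
    rw [dist_zero_right, Real.norm_of_nonneg (by positivity)]
    change 2 ≤ (k + 1 : ℝ) * ‖y‖ ^ 2
    rw [div_lt_iff₀ hk0] at hy2
    linarith
  rw [annularCutoff, e1, e2, sub_zero]

variable [NormedAddCommGroup F]

/-- Bounded maps on `E \ {0}` whose Lipschitz constant at `x` is at most `K / ‖x‖`, such as the
functions that are constant along rays and Lipschitz on a sphere. -/
structure ScaleLipschitz (K M : ℝ) (h : E → F) : Prop where
  norm_sub_le : ∀ x y, x ≠ 0 → y ≠ 0 → ‖h x - h y‖ ≤ K / ‖x‖ * ‖x - y‖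
  norm_le : ∀ x, x ≠ 0 → ‖h x‖ ≤ M
  lip_nonneg : 0 ≤ K
  bound_nonneg : 0 ≤ M

namespace ScaleLipschitz

variable {K M : ℝ} {h : E → F}

lemma sub_const (hh : ScaleLipschitz K M h) (m : F) :
    ScaleLipschitz K (M + ‖m‖) fun x => h x - m where
  norm_sub_le x y hx hy := by simpa using hh.norm_sub_le x y hx hy
  norm_le x hx := (_root_.norm_sub_le _ _).trans (by gcongr; exact hh.norm_le x hx)
  lip_nonneg := hh.lip_nonneg
  bound_nonneg := add_nonneg hh.bound_nonneg (norm_nonneg _)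

variable [NormedSpace ℝ F]

/-- A Lipschitz factor vanishing at the origin satisfies |c x| ≤ C‖x‖, which cancels the blow-up
K/‖x‖ of the local Lipschitz constant and erases the arbitrary value of `h` at `0`. -/
lemma lipschitzWith_smul (hh : ScaleLipschitz K M h) {c : E → ℝ} {C : NNReal}
    (hc : LipschitzWith C c) (hc0 : c 0 = 0) :
    LipschitzWith (C * K.toNNReal + C * M.toNNReal) fun x => c x • h x := by
  have hcx : ∀ x, |c x| ≤ C * ‖x‖ := fun x => by
    simpa [hc0] using hc.norm_sub_le x 0
  have hle : ∀ x, ‖c x • h x‖ ≤ C * M * ‖x‖ := fun x => by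
    rcases eq_or_ne x 0 with rfl | hx
    · simp [hc0]
    · rw [norm_smul, Real.norm_eq_abs]
      calc |c x| * ‖h x‖ ≤ C * ‖x‖ * M :=
            mul_le_mul (hcx x) (hh.norm_le x hx) (norm_nonneg _) (by positivity)
        _ = _ := by ring
  have hK := hh.lip_nonneg
  have hM := hh.bound_nonneg
  refine LipschitzWith.of_dist_le_mul fun x y => ?_
  rw [dist_eq_norm, dist_eq_norm]
  push_cast
  rw [Real.coe_toNNReal _ hK, Real.coe_toNNReal _ hM, add_mul]
  have hKn : 0 ≤ C * K * ‖x - y‖ := by positivity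
  rcases eq_or_ne x 0 with rfl | hx
  · have := hle y
    simp only [hc0, zero_smul, zero_sub, norm_neg] at hKn ⊢
    linarith
  rcases eq_or_ne y 0 with rfl | hy
  · have := hle x
    simp only [hc0, zero_smul, sub_zero] at hKn ⊢
    linarith
  have hx0 : 0 < ‖x‖ := norm_pos_iff.2 hx
  -- The difference of `h` is paired with `c x`, since the Lipschitz bound carries ‖x‖ and not ‖y‖
  -- in its denominator.
  have e : c x • h x - c y • h y = c x • (h x - h y) + (c x - c y) • h y := by module
  rw [e]
  refine (norm_add_le _ _).trans (add_le_add ?_ ?_)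
  · rw [norm_smul, Real.norm_eq_abs]
    calc |c x| * ‖h x - h y‖ ≤ C * ‖x‖ * (K / ‖x‖ * ‖x - y‖) :=
          mul_le_mul (hcx x) (hh.norm_sub_le x y hx hy) (norm_nonneg _) (by positivity)
      _ = C * K * ‖x - y‖ := by field_simp
  · rw [norm_smul]
    calc ‖c x - c y‖ * ‖h y‖ ≤ C * ‖x - y‖ * M :=
          mul_le_mul (hc.norm_sub_le x y) (hh.norm_le y hy) (norm_nonneg _) (by positivity)
      _ = C * M * ‖x - y‖ := by ring

lemma norm_annularCutoff_smul_le (hh : ScaleLipschitz K M h) (k : ℕ) (x : E) :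
    ‖annularCutoff k x • h x‖ ≤ M := by
  rcases eq_or_ne x 0 with rfl | hx
  · simpa [annularCutoff_zero] using hh.bound_nonneg
  · rw [norm_smul, Real.norm_eq_abs, ← one_mul M]
    exact mul_le_mul (abs_annularCutoff_le_one k x) (hh.norm_le x hx) (norm_nonneg _) zero_le_one

end ScaleLipschitz

variable [NormedSpace ℝ F]

lemma eventually_annularCutoff_smul_eventuallyEq (h : E → F) {x : E} (hx : x ≠ 0) :
    ∀ᶠ k : ℕ in atTop, (fun y => annularCutoff k y • h y) =ᶠ[𝓝 x] h := by
  filter_upwards [eventually_annularCutoff_eq_one hx] with k hk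
  filter_upwards [hk] with y hy
  rw [hy, one_smul]

variable [InnerProductSpace ℝ E]

lemma contDiff_annularCutoff (k : ℕ) : ContDiff ℝ ∞ (annularCutoff k : E → ℝ) := by
  unfold annularCutoff
  exact (lineBump.contDiff.comp (contDiff_const.mul (contDiff_norm_sq ℝ))).sub
    (lineBump.contDiff.comp (contDiff_const.mul (contDiff_norm_sq ℝ)))

lemma hasCompactSupport_bump_mul_norm_sq [FiniteDimensional ℝ E] {s : ℝ} (hs : 0 < s) :
    HasCompactSupport fun x : E => lineBump (s * ‖x‖ ^ 2) := by
  refine HasCompactSupport.of_support_subset_isCompact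
    (isCompact_closedBall (0 : E) √(2 / s)) fun x hx => ?_
  rw [Function.mem_support] at hx
  by_contra h
  rw [Metric.mem_closedBall, dist_zero_right, not_le] at h
  refine hx (lineBump.zero_of_le_dist ?_)
  rw [dist_zero_right, Real.norm_of_nonneg (by positivity)]
  change 2 ≤ s * ‖x‖ ^ 2
  have := (Real.sqrt_lt' ((Real.sqrt_nonneg _).trans_lt h)).1 h
  rw [div_lt_iff₀ hs] at this
  linarith

lemma hasCompactSupport_annularCutoff [FiniteDimensional ℝ E] (k : ℕ) :
    HasCompactSupport (annularCutoff k : E → ℝ) :=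
  (hasCompactSupport_bump_mul_norm_sq (by positivity)).sub
    (hasCompactSupport_bump_mul_norm_sq (by positivity))

lemma exists_lipschitzWith_annularCutoff [FiniteDimensional ℝ E] (k : ℕ) :
    ∃ C, LipschitzWith C (annularCutoff k : E → ℝ) :=
  ((contDiff_annularCutoff k).of_le (by simp)).lipschitzWith_of_hasCompactSupport
    (hasCompactSupport_annularCutoff k) one_ne_zero

variable (E) in
-- The bound is uniform in `k` by scaling: for β = `lineBump` and t = s‖x‖², ‖x‖ times the gradient
-- norm of β(s‖x‖²) is 2|t β'(t)|, bounded independently of s. The two bumps give the factor 4.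
lemma exists_norm_fderiv_annularCutoff_le :
    ∃ B : ℝ, 0 ≤ B ∧ ∀ (k : ℕ) (x : E), x ≠ 0 → ‖fderiv ℝ (annularCutoff k) x‖ ≤ B / ‖x‖ := by
  have hcs : HasCompactSupport fun t : ℝ => t * deriv lineBump t :=
    (lineBump.hasCompactSupport.deriv).mul_left
  have hcont : Continuous fun t : ℝ => t * deriv lineBump t :=
    continuous_id.mul (lineBump.contDiff.continuous_deriv (n := 1) le_rfl)
  obtain ⟨B, hB⟩ := hcont.bounded_above_of_compact_support hcs
  have hB0 : 0 ≤ B := (norm_nonneg _).trans (hB 0)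
  have hd : ∀ (s : ℝ) (x : E), HasFDerivAt (fun x : E => lineBump (s * ‖x‖ ^ 2))
      (deriv lineBump (s * ‖x‖ ^ 2) • s • (2 • innerSL ℝ x)) x := fun s x => by
    have h1 : HasFDerivAt (fun y : E => s * ‖y‖ ^ 2) (s • (2 • innerSL ℝ x)) x :=
      ((hasStrictFDerivAt_norm_sq x).hasFDerivAt).const_mul s
    have h2 : HasDerivAt lineBump (deriv lineBump (s * ‖x‖ ^ 2)) (s * ‖x‖ ^ 2) :=
      (lineBump.contDiff.differentiable (n := 1) one_ne_zero _).hasDerivAt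
    have h3 := h2.comp_hasFDerivAt (f := fun y : E => s * ‖y‖ ^ 2) x h1
    exact h3
  have hn : ∀ (s : ℝ) (x : E), x ≠ 0 →
      ‖deriv lineBump (s * ‖x‖ ^ 2) • s • (2 • innerSL ℝ x : E →L[ℝ] ℝ)‖ ≤ 2 * B / ‖x‖ := by
    intro s x hx
    have hx0 : 0 < ‖x‖ := norm_pos_iff.2 hx
    have h := hB (s * ‖x‖ ^ 2)
    rw [norm_mul, norm_mul, norm_pow, norm_norm] at h
    rw [le_div_iff₀ hx0, norm_smul, norm_smul, two_nsmul]
    have h2 : ‖innerSL ℝ x + innerSL ℝ x‖ ≤ 2 * ‖x‖ :=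
      (norm_add_le _ _).trans_eq (by rw [innerSL_apply_norm]; ring)
    calc _ ≤ ‖deriv lineBump (s * ‖x‖ ^ 2)‖ * (‖s‖ * (2 * ‖x‖)) * ‖x‖ := by gcongr
      _ = 2 * (‖s‖ * ‖x‖ ^ 2 * ‖deriv lineBump (s * ‖x‖ ^ 2)‖) := by ring
      _ ≤ 2 * B := by gcongr
  refine ⟨4 * B, by positivity, fun k x hx => ?_⟩
  have h : HasFDerivAt (annularCutoff k) _ x := (hd (k + 1 : ℝ)⁻¹ x).sub (hd (k + 1 : ℝ) x)
  rw [h.fderiv]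
  refine (norm_sub_le _ _).trans ((add_le_add (hn _ x hx) (hn _ x hx)).trans_eq ?_)
  ring

namespace ScaleLipschitz

variable {K M : ℝ} {h : E → F}

lemma norm_fderiv_le (hh : ScaleLipschitz K M h) {x : E} (hx : x ≠ 0) :
    ‖fderiv ℝ h x‖ ≤ K / ‖x‖ := by
  refine norm_fderiv_le_of_lip' ℝ (div_nonneg hh.lip_nonneg (norm_nonneg _)) ?_
  filter_upwards [isOpen_ne.mem_nhds hx] with y hy
  rw [norm_sub_rev, norm_sub_rev y]
  exact hh.norm_sub_le x y hx hy

lemma exists_lipschitzWith_annularCutoff_smul [FiniteDimensional ℝ E] (hh : ScaleLipschitz K M h)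
    (k : ℕ) : ∃ C, LipschitzWith C fun x => annularCutoff k x • h x := by
  obtain ⟨C, hC⟩ := exists_lipschitzWith_annularCutoff (E := E) k
  exact ⟨_, hh.lipschitzWith_smul hC (annularCutoff_zero k)⟩

/-- Cutting off costs a gradient of the same order 1/‖x‖ as that of `h` itself, so one dominating
function serves every `k`. -/
lemma norm_fderiv_annularCutoff_smul_le (hh : ScaleLipschitz K M h) {B : ℝ} {k : ℕ} {x : E}
    (hB : ‖fderiv ℝ (annularCutoff k) x‖ ≤ B / ‖x‖) (hx : x ≠ 0) (hd : DifferentiableAt ℝ h x) :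
    ‖fderiv ℝ (fun x => annularCutoff k x • h x) x‖ ≤ (K + B * M) / ‖x‖ := by
  have hc : DifferentiableAt ℝ (annularCutoff k) x :=
    (contDiff_annularCutoff k).differentiable (by simp) x
  rw [fderiv_fun_smul hc hd]
  refine (norm_add_le _ _).trans ?_
  rw [add_div]
  refine add_le_add ?_ ?_
  · rw [norm_smul, ← one_mul (K / ‖x‖), Real.norm_eq_abs]
    exact mul_le_mul (abs_annularCutoff_le_one k x) (hh.norm_fderiv_le hx) (norm_nonneg _)
      zero_le_one
  · rw [ContinuousLinearMap.norm_smulRight_apply]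
    calc _ ≤ B / ‖x‖ * M := mul_le_mul hB (hh.norm_le x hx) (norm_nonneg _)
            ((norm_nonneg _).trans hB)
      _ = _ := by ring

end ScaleLipschitz

/-- Rademacher holds for the countably many cut-off maps, and near each nonzero point one of them
coincides with `h`. -/
lemma ScaleLipschitz.ae_differentiableAt [FiniteDimensional ℝ E] [MeasurableSpace E] [BorelSpace E]
    [Nontrivial E] [FiniteDimensional ℝ F] {K M : ℝ} {h : E → F} (hh : ScaleLipschitz K M h) :
    ∀ᵐ x, DifferentiableAt ℝ h x := by
  have h1 : ∀ᵐ x : E, ∀ k : ℕ, DifferentiableAt ℝ (fun y => annularCutoff k y • h y) x :=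
    ae_all_iff.2 fun k => by
      obtain ⟨C, hC⟩ := hh.exists_lipschitzWith_annularCutoff_smul k
      exact hC.ae_differentiableAt
  have h2 : ∀ᵐ x : E, x ≠ 0 := Measure.ae_ne volume 0
  filter_upwards [h1, h2] with x hx hx0
  obtain ⟨k, hk⟩ := (eventually_annularCutoff_smul_eventuallyEq h hx0).exists
  exact (hx k).congr_of_eventuallyEq hk.symm

end AnnularCutoff

/-! ### Independence of norm and direction; radial moments. -/

section Polar

open Set Metric

variable {E : Type*} [NormedAddCommGroup E] [InnerProductSpace ℝ E] [FiniteDimensional ℝ E]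
  [MeasurableSpace E] [BorelSpace E]

lemma integral_polar (F : E → ℝ) [Nontrivial E] :
    ∫ x, F x = ∫ p : sphere (0 : E) 1 × Ioi (0 : ℝ), F (p.2.1 • p.1.1)
      ∂(volume : Measure E).toSphere.prod (.volumeIoiPow (Module.finrank ℝ E - 1)) := by
  have h := (volume : Measure E).measurePreserving_homeomorphUnitSphereProd.integral_comp
    (homeomorphUnitSphereProd E).measurableEmbedding
    (fun p : sphere (0 : E) 1 × Ioi (0 : ℝ) => F (p.2.1 • p.1.1))
  have h1 : ∫ x, F x = ∫ x : ({(0)}ᶜ : Set E), F x.1 ∂(Measure.comap Subtype.val volume) := by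
    rw [integral_subtype_comap (measurableSet_singleton _).compl F, restrict_compl_singleton]
  rw [← h, h1]
  refine integral_congr_ae (.of_forall fun x => ?_)
  have hx : ‖x.1‖ ≠ 0 := norm_ne_zero_iff.2 x.2
  simp [smul_smul, mul_inv_cancel₀ hx]

lemma integrable_polar_iff (F : E → ℝ) [Nontrivial E] :
    Integrable F ↔ Integrable (fun p : sphere (0 : E) 1 × Ioi (0 : ℝ) => F (p.2.1 • p.1.1))
      ((volume : Measure E).toSphere.prod (.volumeIoiPow (Module.finrank ℝ E - 1))) := by
  have h := (volume : Measure E).measurePreserving_homeomorphUnitSphereProd.integrable_comp_emb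
    (homeomorphUnitSphereProd E).measurableEmbedding
    (g := fun p : sphere (0 : E) 1 × Ioi (0 : ℝ) => F (p.2.1 • p.1.1))
  have h1 : Integrable F ↔
      Integrable (fun x : ({(0)}ᶜ : Set E) => F x.1) (Measure.comap Subtype.val volume) := by
    rw [← restrict_compl_singleton (μ := (volume : Measure E)) 0, ← IntegrableOn,
      integrableOn_iff_comap_subtypeVal (by measurability), restrict_compl_singleton]
    rfl
  rw [← h, h1]
  refine integrable_congr (.of_forall fun x => ?_)
  have hx : ‖x.1‖ ≠ 0 := norm_ne_zero_iff.2 x.2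
  simp [smul_smul, mul_inv_cancel₀ hx]

variable {G : E → ℝ} {q : ℝ → ℝ}

lemma integral_radial_mul [Nontrivial E] (hG : ∀ t : ℝ, 0 < t → ∀ x, G (t • x) = G x) :
    ∫ x, q ‖x‖ * G x = (∫ s, G s ∂(volume : Measure E).toSphere) *
      ∫ r, q r ∂Measure.volumeIoiPow (Module.finrank ℝ E - 1) := by
  rw [integral_polar, ← integral_prod_mul (fun s : sphere (0 : E) 1 => G s)
    (fun r : Ioi (0 : ℝ) => q r)]
  refine integral_congr_ae (.of_forall fun p => ?_)
  have hp : (0 : ℝ) < p.2.1 := p.2.2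
  simp only [norm_smul, hG _ hp, Real.norm_of_nonneg hp.le, norm_eq_of_mem_sphere, mul_one]
  ring

lemma integrable_radial_mul_iff [Nontrivial E] (hG : ∀ t : ℝ, 0 < t → ∀ x, G (t • x) = G x) :
    Integrable (fun x => q ‖x‖ * G x) ↔
      Integrable (fun p : sphere (0 : E) 1 × Ioi (0 : ℝ) => G p.1 * q p.2)
        ((volume : Measure E).toSphere.prod (.volumeIoiPow (Module.finrank ℝ E - 1))) := by
  rw [integrable_polar_iff]
  refine integrable_congr (.of_forall fun p => ?_)
  have hp : (0 : ℝ) < p.2.1 := p.2.2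
  simp only [norm_smul, hG _ hp, Real.norm_of_nonneg hp.le, norm_eq_of_mem_sphere, mul_one]
  ring

/-- The radial profile of the Gaussian density. -/
noncomputable def gaussProfile (E : Type*) [NormedAddCommGroup E] [InnerProductSpace ℝ E]
    [FiniteDimensional ℝ E] [MeasurableSpace E] [BorelSpace E] (r : ℝ) : ℝ :=
  (gaussNorm E)⁻¹ * Real.exp (-(1 / 2) * r ^ 2)

/-- The norm and the direction of a standard Gaussian vector are independent: integrals factor. -/
theorem integral_radial_mul_stdGaussian [Nontrivial E]
    (hG : ∀ t : ℝ, 0 < t → ∀ x, G (t • x) = G x) :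
    ∫ x, q ‖x‖ * G x ∂stdGaussian E =
      (∫ x, q ‖x‖ ∂stdGaussian E) * ∫ x, G x ∂stdGaussian E := by
  have e1 : ∫ x, q ‖x‖ * G x ∂stdGaussian E =
      ∫ x : E, (fun r => gaussProfile E r * q r) ‖x‖ * G x := by
    rw [integral_stdGaussian]
    exact integral_congr_ae (.of_forall fun x => by simp [gaussProfile, gaussDensity]; ring)
  have e2 : ∫ x, q ‖x‖ ∂stdGaussian E =
      ∫ x : E, (fun r => gaussProfile E r * q r) ‖x‖ * (fun _ => 1) x := by
    rw [integral_stdGaussian]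
    exact integral_congr_ae (.of_forall fun x => by simp [gaussProfile, gaussDensity])
  have e3 : ∫ x, G x ∂stdGaussian E = ∫ x : E, gaussProfile E ‖x‖ * G x := by
    rw [integral_stdGaussian]
    exact integral_congr_ae (.of_forall fun x => by simp [gaussProfile, gaussDensity])
  -- The total mass 1, factored in polar coordinates, supplies the normalisation that separates the
  -- two integrals.
  have e4 : (1 : ℝ) = ∫ x : E, gaussProfile E ‖x‖ * (fun _ => 1) x := by
    have h1 : ∫ _x, (1 : ℝ) ∂stdGaussian E = 1 := by simp
    rw [integral_stdGaussian] at h1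
    refine h1.symm.trans ?_
    exact integral_congr_ae (.of_forall fun x => by simp [gaussProfile, gaussDensity])
  rw [integral_radial_mul fun _ _ _ => rfl] at e4
  rw [integral_radial_mul (q := fun r => gaussProfile E r * q r) fun _ _ _ => rfl] at e2
  rw [integral_radial_mul (q := fun r => gaussProfile E r * q r) hG] at e1
  rw [integral_radial_mul hG] at e3
  rw [e1, e2, e3]
  linear_combination ((∫ s, G s ∂(volume : Measure E).toSphere) *
      ∫ r, (fun r => gaussProfile E r * q r) r ∂Measure.volumeIoiPow (Module.finrank ℝ E - 1)) * e4

theorem integrable_radial_mul_stdGaussian [Nontrivial E]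
    (hG : ∀ t : ℝ, 0 < t → ∀ x, G (t • x) = G x)
    (hq : Integrable (fun x => q ‖x‖) (stdGaussian E)) (hGi : Integrable G (stdGaussian E)) :
    Integrable (fun x => q ‖x‖ * G x) (stdGaussian E) := by
  have a1 : Integrable fun x : E => (fun r => gaussProfile E r * q r) ‖x‖ * (fun _ => 1) x :=
    (integrable_stdGaussian_iff.1 hq).congr
      (.of_forall fun x => by simp [gaussProfile, gaussDensity])
  have a2 : Integrable fun x : E => gaussProfile E ‖x‖ * G x :=
    (integrable_stdGaussian_iff.1 hGi).congr
      (.of_forall fun x => by simp [gaussProfile, gaussDensity])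
  rw [integrable_radial_mul_iff (q := fun r => gaussProfile E r * q r) fun _ _ _ => rfl] at a1
  rw [integrable_radial_mul_iff hG] at a2
  have hS : (volume : Measure E).toSphere ≠ 0 := Measure.toSphere_ne_zero _
  have hV : Measure.volumeIoiPow (Module.finrank ℝ E - 1) ≠ 0 := fun h0 => by
    have := Measure.volumeIoiPow_apply_Iio (Module.finrank ℝ E - 1) ⟨1, mem_Ioi.2 one_pos⟩
    rw [h0] at this
    simp at this
    linarith
  have : NeZero (volume : Measure E).toSphere := ⟨hS⟩
  have : NeZero (Measure.volumeIoiPow (Module.finrank ℝ E - 1)) := ⟨hV⟩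
  -- Integrability on the product gives integrability of almost every slice; one slice in each
  -- direction isolates the radial and the angular factor.
  obtain ⟨s, hs⟩ := a1.prod_right_ae.exists
  obtain ⟨r, hr⟩ := a2.prod_left_ae.exists
  have hr0 : gaussProfile E r ≠ 0 :=
    (mul_pos (inv_pos.2 gaussNorm_pos) (Real.exp_pos _)).ne'
  have hGs : Integrable (fun s : sphere (0 : E) 1 => G s) (volume : Measure E).toSphere :=
    (hr.mul_const (gaussProfile E r)⁻¹).congr (.of_forall fun s => by
      simp [mul_assoc, mul_inv_cancel₀ hr0])
  have hqs : Integrable (fun r : Ioi (0 : ℝ) => gaussProfile E r * q r)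
      (.volumeIoiPow (Module.finrank ℝ E - 1)) := by simpa using hs
  have h := (integrable_radial_mul_iff (q := fun r => gaussProfile E r * q r) hG).2
    (hGs.mul_prod hqs)
  rw [integrable_stdGaussian_iff]
  exact h.congr (.of_forall fun x => by simp [gaussProfile, gaussDensity]; ring)

/-- The moments of the half-line Gaussian density satisfy a two-step recursion. -/
lemma integral_pow_add_two_mul_exp (m : ℕ) :
    ∫ r in Ioi (0 : ℝ), r ^ (m + 2) * Real.exp (-(1 / 2) * r ^ 2) =
      (m + 1) * ∫ r in Ioi (0 : ℝ), r ^ m * Real.exp (-(1 / 2) * r ^ 2) := by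
  have h : ∀ k : ℕ, ∫ r in Ioi (0 : ℝ), r ^ k * Real.exp (-(1 / 2) * r ^ 2) =
      (1 / 2 : ℝ) ^ (-((k : ℝ) + 1) / 2) * (1 / 2) * Real.Gamma (((k : ℝ) + 1) / 2) := fun k => by
    rw [← integral_rpow_mul_exp_neg_mul_rpow two_pos (by linarith [k.cast_nonneg (α := ℝ)])
      (by norm_num)]
    simp
  rw [h, h]
  -- Raising the exponent by 2 shifts the Gamma argument by 1, so Γ(s+1) = sΓ(s) applies.
  have e1 : (((m + 2 : ℕ) : ℝ) + 1) / 2 = ((m : ℝ) + 1) / 2 + 1 := by push_cast; ring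
  have e2 : -(((m + 2 : ℕ) : ℝ) + 1) / 2 = -((m : ℝ) + 1) / 2 + (-1) := by push_cast; ring
  rw [e1, e2, Real.Gamma_add_one (by positivity), Real.rpow_add (by norm_num), Real.rpow_neg_one]
  ring

lemma integrableOn_pow_mul_exp (m : ℕ) :
    IntegrableOn (fun r : ℝ => r ^ m * Real.exp (-(1 / 2) * r ^ 2)) (Ioi 0) := by
  have := integrableOn_rpow_mul_exp_neg_mul_sq (b := 1 / 2) (by norm_num) (s := m)
    (by linarith [m.cast_nonneg (α := ℝ)])
  simpa using this

lemma integral_radial_stdGaussian [Nontrivial E] (q : ℝ → ℝ) :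
    ∫ x, q ‖x‖ ∂stdGaussian E = (gaussNorm E)⁻¹ * (Module.finrank ℝ E *
      (volume : Measure E).real (ball 0 1)) * ∫ r in Ioi (0 : ℝ),
        r ^ (Module.finrank ℝ E - 1) * q r * Real.exp (-(1 / 2) * r ^ 2) := by
  have h := integral_fun_norm_addHaar (volume : Measure E) fun r =>
    (gaussNorm E)⁻¹ * Real.exp (-(1 / 2) * r ^ 2) * q r
  rw [integral_stdGaussian]
  simp only [gaussDensity, smul_eq_mul, nsmul_eq_mul] at h ⊢
  have e : ∀ y : ℝ, y ^ (Module.finrank ℝ E - 1) *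
      ((gaussNorm E)⁻¹ * Real.exp (-(1 / 2) * y ^ 2) * q y) = (gaussNorm E)⁻¹ *
      (y ^ (Module.finrank ℝ E - 1) * q y * Real.exp (-(1 / 2) * y ^ 2)) := fun y => by ring
  simp_rw [e, integral_const_mul] at h
  rw [h]
  ring

lemma integral_radial_one [Nontrivial E] : (gaussNorm E)⁻¹ * (Module.finrank ℝ E *
      (volume : Measure E).real (ball 0 1)) * ∫ r in Ioi (0 : ℝ),
        r ^ (Module.finrank ℝ E - 1) * Real.exp (-(1 / 2) * r ^ 2) = 1 := by
  simpa using (integral_radial_stdGaussian (E := E) fun _ => 1).symm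

theorem integral_norm_sq_stdGaussian [Nontrivial E] :
    ∫ x, ‖x‖ ^ 2 ∂stdGaussian E = Module.finrank ℝ E := by
  obtain ⟨m, hm⟩ : ∃ m, Module.finrank ℝ E = m + 1 :=
    Nat.exists_eq_succ_of_ne_zero Module.finrank_pos.ne'
  have h1 := integral_radial_one (E := E)
  have h2 := integral_radial_stdGaussian (E := E) fun r => r ^ 2
  rw [hm, Nat.add_sub_cancel] at h1 h2
  simp_rw [← pow_add] at h2
  rw [integral_pow_add_two_mul_exp] at h2
  rw [h2, hm]
  push_cast at h1 ⊢
  linear_combination ((m : ℝ) + 1) * h1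

/-- Dimension `m + 3` gives the polar weight r^(m+2), which absorbs r⁻² and leaves the integrable
r^m. -/
lemma integrable_inv_norm_sq_stdGaussian (hE : 3 ≤ Module.finrank ℝ E) :
    Integrable (fun x => (‖x‖ ^ 2)⁻¹) (stdGaussian E) := by
  have : Nontrivial E := Module.nontrivial_of_finrank_pos (R := ℝ) (by omega)
  obtain ⟨m, hm⟩ := Nat.exists_eq_add_of_le' hE
  rw [integrable_stdGaussian_iff]
  have h := (integrable_fun_norm_addHaar (volume : Measure E)
    (f := fun r => (gaussNorm E)⁻¹ * Real.exp (-(1 / 2) * r ^ 2) * (r ^ 2)⁻¹)).2 ?_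
  · exact h
  · refine IntegrableOn.congr_fun ((integrableOn_pow_mul_exp m).const_mul (gaussNorm E)⁻¹)
      (fun r hr => ?_) measurableSet_Ioi
    have hr0 : r ≠ 0 := ne_of_gt hr
    simp only [hm, smul_eq_mul, show m + 3 - 1 = m + 2 from rfl]
    field_simp
    ring

theorem integral_inv_norm_sq_stdGaussian (hE : 3 ≤ Module.finrank ℝ E) :
    ∫ x, (‖x‖ ^ 2)⁻¹ ∂stdGaussian E = ((Module.finrank ℝ E : ℝ) - 2)⁻¹ := by
  have : Nontrivial E := Module.nontrivial_of_finrank_pos (R := ℝ) (by omega)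
  obtain ⟨m, hm⟩ := Nat.exists_eq_add_of_le' hE
  have h1 := integral_radial_one (E := E)
  have h2 := integral_radial_stdGaussian (E := E) fun r => (r ^ 2)⁻¹
  have e : ∫ r in Ioi (0 : ℝ), r ^ (m + 2) * (r ^ 2)⁻¹ * Real.exp (-(1 / 2) * r ^ 2) =
      ∫ r in Ioi (0 : ℝ), r ^ m * Real.exp (-(1 / 2) * r ^ 2) := by
    refine setIntegral_congr_fun measurableSet_Ioi fun r hr => ?_
    have hr0 : r ≠ 0 := ne_of_gt hr
    field_simp
    ring
  rw [hm, show m + 3 - 1 = m + 2 from rfl] at h1 h2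
  rw [integral_pow_add_two_mul_exp] at h1
  rw [e] at h2
  rw [h2, hm]
  refine eq_inv_of_mul_eq_one_left ?_
  push_cast at h1 ⊢
  linear_combination h1

end Polar

/-! ### Radial extensions and their Gaussian inequalities. -/

section RadialExtension

open scoped Topology
open Filter

lemma ScaleLipschitz.continuousOn {E F : Type*} [NormedAddCommGroup E] [NormedAddCommGroup F]
    {K M : ℝ} {h : E → F} (hh : ScaleLipschitz K M h) : ContinuousOn h {0}ᶜ := by
  intro x hx
  refine ContinuousAt.continuousWithinAt ?_
  rw [ContinuousAt, tendsto_iff_norm_sub_tendsto_zero]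
  have h0 : Tendsto (fun y => K / ‖x‖ * ‖x - y‖) (𝓝 x) (𝓝 0) := by
    have : Continuous fun y => K / ‖x‖ * ‖x - y‖ := by fun_prop
    simpa using this.tendsto x
  refine squeeze_zero' (.of_forall fun _ => norm_nonneg _) ?_ h0
  filter_upwards [isOpen_ne.mem_nhds (Set.mem_compl_singleton_iff.1 hx)] with y hy
  rw [norm_sub_rev]
  exact hh.norm_sub_le x y hx hy

lemma ScaleLipschitz.aestronglyMeasurable {E F : Type*} [NormedAddCommGroup E]
    [MeasurableSpace E] [BorelSpace E] [SecondCountableTopology E] [NormedAddCommGroup F]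
    {K M : ℝ} {h : E → F} (hh : ScaleLipschitz K M h) {μ : Measure E} (hμ : ∀ᵐ x ∂μ, x ≠ 0) :
    AEStronglyMeasurable h μ := by
  have := hh.continuousOn.aestronglyMeasurable (μ := μ) (measurableSet_singleton 0).compl
  rwa [Measure.restrict_eq_self_of_ae_mem (by simpa using hμ)] at this

section Gaussian

variable {ι : Type*} [Fintype ι] [DecidableEq ι]

lemma ae_ne_zero_stdGaussian {E : Type*} [NormedAddCommGroup E] [InnerProductSpace ℝ E]
    [FiniteDimensional ℝ E] [MeasurableSpace E] [BorelSpace E] [Nontrivial E] :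
    ∀ᵐ x ∂stdGaussian E, x ≠ 0 :=
  stdGaussian_absolutelyContinuous.ae_le (Measure.ae_ne volume 0)

/-- Each cut-off field is Lipschitz with compact support and agrees with `h` near any given nonzero
point for large `k`. Gradients are dominated by a multiple of 1/‖x‖, square integrable from
dimension 3 on. -/
theorem ScaleLipschitz.steinPoincare (hι : 3 ≤ Fintype.card ι) {K M : ℝ}
    {h : EuclideanSpace ℝ ι → EuclideanSpace ℝ ι} (hh : ScaleLipschitz K M h) :
    SteinPoincare h (fderiv ℝ h) := by
  have hE : 3 ≤ Module.finrank ℝ (EuclideanSpace ℝ ι) := by simpa using hι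
  have : Nontrivial (EuclideanSpace ℝ ι) := Module.nontrivial_of_finrank_pos (R := ℝ) (by omega)
  obtain ⟨B, hB0, hB⟩ := exists_norm_fderiv_annularCutoff_le (EuclideanSpace ℝ ι)
  have hne : ∀ᵐ x ∂stdGaussian (EuclideanSpace ℝ ι), x ≠ 0 := ae_ne_zero_stdGaussian
  have hd : ∀ᵐ x ∂stdGaussian (EuclideanSpace ℝ ι), DifferentiableAt ℝ h x :=
    stdGaussian_absolutelyContinuous.ae_le hh.ae_differentiableAt
  refine SteinPoincare.of_tendsto (M := M) (w := fun x => (K + B * M) / ‖x‖)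
    (G := fun k x => annularCutoff k x • h x)
    (G' := fun k => fderiv ℝ fun x => annularCutoff k x • h x) (fun k => ?_) (fun k => ?_)
    (fun k => (measurable_fderiv ℝ _).aestronglyMeasurable)
    (fun k => .of_forall fun x => hh.norm_annularCutoff_smul_le k x)
    (fun k => ?_) ?_ ?_ ?_
  · obtain ⟨C, hC⟩ := hh.exists_lipschitzWith_annularCutoff_smul k
    exact SteinPoincare.of_lipschitz hC (hasCompactSupport_annularCutoff k).smul_right
  · obtain ⟨C, hC⟩ := hh.exists_lipschitzWith_annularCutoff_smul k
    exact hC.continuous.aestronglyMeasurable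
  · filter_upwards [hne, hd] with x hx hdx
    exact hh.norm_fderiv_annularCutoff_smul_le (hB k x hx) hx hdx
  · simp_rw [div_pow, div_eq_mul_inv]
    exact (integrable_inv_norm_sq_stdGaussian hE).const_mul _
  · filter_upwards [hne] with x hx
    refine tendsto_const_nhds.congr' ?_
    filter_upwards [eventually_annularCutoff_smul_eventuallyEq h hx] with k hk
    exact hk.eq_of_nhds.symm
  · filter_upwards [hne] with x hx
    refine tendsto_const_nhds.congr' ?_
    filter_upwards [eventually_annularCutoff_smul_eventuallyEq h hx] with k hk
    exact hk.fderiv_eq.symm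

end Gaussian

/-- Serves two purposes: in the source it controls the projection to the sphere, in the target the
normalisation of a field. -/
lemma scaleLipschitz_normalize (E : Type*) [NormedAddCommGroup E] [InnerProductSpace ℝ E] :
    ScaleLipschitz 2 1 fun y : E => ‖y‖⁻¹ • y where
  norm_sub_le x y hx hy := by
    have hx0 : 0 < ‖x‖ := norm_pos_iff.2 hx
    have hy0 : 0 < ‖y‖ := norm_pos_iff.2 hy
    have e : ‖x‖⁻¹ • x - ‖y‖⁻¹ • y = ‖x‖⁻¹ • (x - y) + (‖x‖⁻¹ - ‖y‖⁻¹) • y := by module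
    rw [e]
    refine (norm_add_le _ _).trans ?_
    rw [norm_smul, norm_smul, norm_inv, norm_norm]
    have h2 : ‖‖x‖⁻¹ - ‖y‖⁻¹‖ * ‖y‖ = ‖x‖⁻¹ * |‖y‖ - ‖x‖| := by
      rw [inv_sub_inv hx0.ne' hy0.ne', norm_div, norm_mul, norm_norm, norm_norm, Real.norm_eq_abs]
      field_simp
    have h3 : |‖y‖ - ‖x‖| ≤ ‖x - y‖ := by
      rw [norm_sub_rev]; exact abs_norm_sub_norm_le y x
    rw [h2]
    calc ‖x‖⁻¹ * ‖x - y‖ + ‖x‖⁻¹ * |‖y‖ - ‖x‖| ≤ ‖x‖⁻¹ * ‖x - y‖ + ‖x‖⁻¹ * ‖x - y‖ := by gcongr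
      _ = 2 / ‖x‖ * ‖x - y‖ := by ring
  norm_le x hx := by
    rw [norm_smul, norm_inv, norm_norm, inv_mul_cancel₀ (norm_ne_zero_iff.2 hx)]
  lip_nonneg := by norm_num
  bound_nonneg := zero_le_one

lemma differentiableAt_normalize {E : Type*} [NormedAddCommGroup E] [InnerProductSpace ℝ E]
    {y : E} (hy : y ≠ 0) : DifferentiableAt ℝ (fun y : E => ‖y‖⁻¹ • y) y :=
  ((differentiableAt_id.norm ℝ hy).inv (norm_ne_zero_iff.2 hy)).smul differentiableAt_id

variable {n : ℕ} {R : ℝ} {f g : EuclideanSpace ℝ (Fin n) → EuclideanSpace ℝ (Fin n)}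

lemma div_norm_smul_smul {t : ℝ} (ht : 0 < t) (x : EuclideanSpace ℝ (Fin n)) :
    (R / ‖t • x‖) • t • x = (R / ‖x‖) • x := by
  rw [norm_smul, Real.norm_of_nonneg ht.le, smul_smul]
  congr 1
  rcases eq_or_ne ‖x‖ 0 with h | h
  · simp [h]
  · field_simp

lemma radialExt_smul {t : ℝ} (ht : 0 < t) (x : EuclideanSpace ℝ (Fin n)) :
    radialExt R f (t • x) = radialExt R f x := by
  unfold radialExt
  rw [div_norm_smul_smul ht]

lemma smul_mem_sphere (hR : 0 < R) {x : EuclideanSpace ℝ (Fin n)} (hx : x ≠ 0) :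
    (R / ‖x‖) • x ∈ Metric.sphere (0 : EuclideanSpace ℝ (Fin n)) R := by
  rw [mem_sphere_zero_iff_norm, norm_smul, Real.norm_of_nonneg (by positivity),
    div_mul_cancel₀ _ (norm_ne_zero_iff.2 hx)]

lemma radialExt_of_mem_sphere (hR : 0 < R) {x : EuclideanSpace ℝ (Fin n)} (hx : ‖x‖ = R) :
    radialExt R f x = f x := by
  rw [radialExt, hx, div_self hR.ne', one_smul]

/-- Homogeneity of degree -1; at t = R/‖x‖ it compares the gradient at a Gaussian point with the one
on the sphere. -/
lemma fderiv_radialExt_smul {t : ℝ} (ht : 0 < t) (x : EuclideanSpace ℝ (Fin n)) :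
    fderiv ℝ (radialExt R f) x = t • fderiv ℝ (radialExt R f) (t • x) := by
  rw [← fderiv_comp_smul]
  congr 1
  exact funext fun y => (radialExt_smul ht y).symm

lemma differentiableAt_radialExt_smul {t : ℝ} (ht : 0 < t) {x : EuclideanSpace ℝ (Fin n)}
    (hx : DifferentiableAt ℝ (radialExt R f) x) :
    DifferentiableAt ℝ (radialExt R f) (t • x) := by
  have e : radialExt R f = radialExt R f ∘ fun y => t⁻¹ • y :=
    funext fun y => (radialExt_smul (inv_pos.2 ht) y).symm
  rw [e]
  refine DifferentiableAt.comp _ ?_ (differentiableAt_id.const_smul t⁻¹)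
  rwa [smul_smul, inv_mul_cancel₀ ht.ne', one_smul]

lemma fderiv_radialExt_self (x : EuclideanSpace ℝ (Fin n)) :
    fderiv ℝ (radialExt R f) x x = 0 := by
  by_cases hd : DifferentiableAt ℝ (radialExt R f) x
  · have h1 : HasDerivAt (fun t : ℝ => t • x) x 1 := by
      simpa using (hasDerivAt_id (1 : ℝ)).smul_const x
    have h2 : HasFDerivAt (radialExt R f) (fderiv ℝ (radialExt R f) x) ((1 : ℝ) • x) := by
      simpa using hd.hasFDerivAt
    have h3 := h2.comp_hasDerivAt 1 h1
    have h4 : HasDerivAt (radialExt R f ∘ fun t : ℝ => t • x) 0 1 := by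
      refine (hasDerivAt_const (1 : ℝ) (radialExt R f x)).congr_of_eventuallyEq ?_
      filter_upwards [lt_mem_nhds (zero_lt_one (α := ℝ))] with t ht
      exact radialExt_smul ht x
    exact h3.unique h4
  · simp [fderiv_zero_of_not_differentiableAt hd]

/-- Compactness of the sphere makes the Lipschitz constant global; the factor `R * 2` comes from x ↦
R x/‖x‖. -/
lemma exists_scaleLipschitz_radialExt (hR : 0 < R)
    (hf : LocallyLipschitzOn (Metric.sphere 0 R) f) :
    ∃ K M, ScaleLipschitz K M (radialExt R f) := by
  obtain ⟨K, hK⟩ := hf.exists_lipschitzOnWith_of_compact (isCompact_sphere _ _)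
  obtain ⟨M, hM⟩ := (isCompact_sphere (0 : EuclideanSpace ℝ (Fin n)) R).exists_bound_of_continuousOn
    hK.continuousOn
  refine ⟨K * (R * 2), |M|, fun x y hx hy => ?_, fun x hx => ?_, by positivity, abs_nonneg _⟩
  · have h1 := hK.norm_sub_le (smul_mem_sphere hR hx) (smul_mem_sphere hR hy)
    have h2 := (scaleLipschitz_normalize (EuclideanSpace ℝ (Fin n))).norm_sub_le x y hx hy
    have e : (R / ‖x‖) • x - (R / ‖y‖) • y = R • (‖x‖⁻¹ • x - ‖y‖⁻¹ • y) := by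
      simp only [div_eq_mul_inv]; module
    rw [e, norm_smul, Real.norm_of_nonneg hR.le] at h1
    calc _ ≤ K * (R * (2 / ‖x‖ * ‖x - y‖)) := h1.trans (by gcongr)
      _ = _ := by ring
  · exact (hM _ (smul_mem_sphere hR hx)).trans (le_abs_self M)

/-- The regularity of the radial extension of a vector field that suffices for the spherical
inequalities. -/
structure RadiallyRegular (R : ℝ) (f : EuclideanSpace ℝ (Fin n) → EuclideanSpace ℝ (Fin n)) :
    Prop where
  aestronglyMeasurable : AEStronglyMeasurable f (sphereUniform n R)
  bounded : ∃ M, ∀ᵐ x ∂stdGaussian (EuclideanSpace ℝ (Fin n)), ‖radialExt R f x‖ ≤ M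
  differentiable : ∀ᵐ x ∂stdGaussian (EuclideanSpace ℝ (Fin n)),
    DifferentiableAt ℝ (radialExt R f) x
  integrable : Integrable (fun x => hsSq (fderiv ℝ (radialExt R f) ((R / ‖x‖) • x)))
    (stdGaussian (EuclideanSpace ℝ (Fin n)))
  -- The shift matters because the Stein half is not translation invariant; it is later used with
  -- `m` the mean.
  steinPoincare : ∀ m, SteinPoincare (fun x => radialExt R f x - m) (fderiv ℝ (radialExt R f))

lemma nontrivial_euclideanSpace (hn : 3 ≤ n) : Nontrivial (EuclideanSpace ℝ (Fin n)) :=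
  Module.nontrivial_of_finrank_pos (R := ℝ) (by simp; omega)

lemma measurable_div_norm_smul :
    Measurable fun x : EuclideanSpace ℝ (Fin n) => (R / ‖x‖) • x := by fun_prop

lemma ae_norm_eq_sphereUniform (hn : 3 ≤ n) (hR : 0 < R) :
    ∀ᵐ x ∂sphereUniform n R, ‖x‖ = R := by
  have := nontrivial_euclideanSpace hn
  rw [sphereUniform, ae_map_iff measurable_div_norm_smul.aemeasurable
    (measurableSet_eq_fun measurable_norm measurable_const)]
  filter_upwards [ae_ne_zero_stdGaussian] with x hx
  simpa using smul_mem_sphere hR hx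

lemma aestronglyMeasurable_sphereUniform_of_locallyLipschitzOn (hn : 3 ≤ n) (hR : 0 < R)
    (hf : LocallyLipschitzOn (Metric.sphere 0 R) f) :
    AEStronglyMeasurable f (sphereUniform n R) := by
  obtain ⟨K, M, hh⟩ := exists_scaleLipschitz_radialExt hR hf
  have h := hh.aestronglyMeasurable (μ := sphereUniform n R) (by
    filter_upwards [ae_norm_eq_sphereUniform hn hR] with x hx hx0
    simp [hx0, hR.ne] at hx)
  refine h.congr ?_
  filter_upwards [ae_norm_eq_sphereUniform hn hR] with x hx using radialExt_of_mem_sphere hR hx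

theorem RadiallyRegular.of_locallyLipschitzOn (hn : 3 ≤ n) (hR : 0 < R)
    (hf : LocallyLipschitzOn (Metric.sphere 0 R) f) : RadiallyRegular R f := by
  have := nontrivial_euclideanSpace hn
  obtain ⟨K, M, hh⟩ := exists_scaleLipschitz_radialExt hR hf
  refine ⟨aestronglyMeasurable_sphereUniform_of_locallyLipschitzOn hn hR hf, ⟨M, ?_⟩,
    stdGaussian_absolutelyContinuous.ae_le hh.ae_differentiableAt, ?_, fun m => ?_⟩
  · filter_upwards [ae_ne_zero_stdGaussian] with x hx using hh.norm_le x hx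
  · refine Integrable.of_bound (C := n * (K / R) ^ 2) ?_ ?_
    · exact continuous_hsSq.comp_aestronglyMeasurable
        ((measurable_fderiv ℝ _).comp measurable_div_norm_smul).aestronglyMeasurable
    · filter_upwards [ae_ne_zero_stdGaussian] with x hx
      have hy := smul_mem_sphere hR hx
      have hy0 : (R / ‖x‖) • x ≠ 0 := Metric.ne_of_mem_sphere hy hR.ne'
      have h1 := hh.norm_fderiv_le hy0
      rw [mem_sphere_zero_iff_norm.1 hy] at h1
      rw [Real.norm_of_nonneg (hsSq_nonneg _)]
      refine (hsSq_le _).trans ?_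
      rw [Fintype.card_fin]
      gcongr
  · have := (hh.sub_const m).steinPoincare (by simpa using hn)
    rwa [show (fderiv ℝ fun x => radialExt R f x - m) = fderiv ℝ (radialExt R f) from
      funext fun x => fderiv_sub_const m] at this

end RadialExtension

/-! ### Normalised fields. -/

section Normalized

open scoped Topology
open Filter

variable {n : ℕ} {R : ℝ} {f g : EuclideanSpace ℝ (Fin n) → EuclideanSpace ℝ (Fin n)}

lemma radialExt_eventuallyEq_normalize (hR : 0 < R)
    (hfg : ∀ x ∈ Metric.sphere (0 : EuclideanSpace ℝ (Fin n)) R, g x ≠ 0 → f x = ‖g x‖⁻¹ • g x)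
    {x : EuclideanSpace ℝ (Fin n)} (hx : x ≠ 0) (hgx : radialExt R g x ≠ 0)
    (hc : ContinuousAt (radialExt R g) x) :
    radialExt R f =ᶠ[𝓝 x] (fun y => ‖y‖⁻¹ • y) ∘ radialExt R g := by
  filter_upwards [isOpen_ne.mem_nhds hx, hc.eventually_ne hgx] with y hy hgy
  exact hfg _ (smul_mem_sphere hR hy) hgy

lemma norm_fderiv_radialExt_normalize_le (hR : 0 < R)
    (hfg : ∀ x ∈ Metric.sphere (0 : EuclideanSpace ℝ (Fin n)) R, g x ≠ 0 → f x = ‖g x‖⁻¹ • g x)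
    {x : EuclideanSpace ℝ (Fin n)} (hx : x ≠ 0) (hgx : radialExt R g x ≠ 0)
    (hd : DifferentiableAt ℝ (radialExt R g) x) :
    ‖fderiv ℝ (radialExt R f) x‖ ≤ 2 / ‖radialExt R g x‖ * ‖fderiv ℝ (radialExt R g) x‖ := by
  rw [(radialExt_eventuallyEq_normalize hR hfg hx hgx hd.continuousAt).fderiv_eq,
    fderiv_comp x (differentiableAt_normalize hgx) hd]
  refine (ContinuousLinearMap.opNorm_comp_le _ _).trans ?_
  gcongr
  exact (scaleLipschitz_normalize _).norm_fderiv_le hgx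

/-- Moves the gradient from the sphere to the Gaussian point at the price of the independent radial
factor R²/‖x‖², integrable since n ≥ 3. -/
lemma integrable_inv_norm_sq_mul_hsSq (hn : 3 ≤ n) (hR : 0 < R) {a : EuclideanSpace ℝ (Fin n) → ℝ}
    (ha : ∀ t : ℝ, 0 < t → ∀ x, a (t • x) = a x)
    (hint : Integrable (fun x => a x * hsSq (fderiv ℝ (radialExt R g) ((R / ‖x‖) • x)))
      (stdGaussian (EuclideanSpace ℝ (Fin n)))) :
    Integrable (fun x => a x * hsSq (fderiv ℝ (radialExt R g) x))
      (stdGaussian (EuclideanSpace ℝ (Fin n))) := by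
  have := nontrivial_euclideanSpace hn
  have h := integrable_radial_mul_stdGaussian (q := fun r => R ^ 2 * (r ^ 2)⁻¹)
    (fun t ht x => by rw [ha t ht, div_norm_smul_smul ht])
    ((integrable_inv_norm_sq_stdGaussian (by simpa using hn)).const_mul _) hint
  refine h.congr ?_
  filter_upwards [ae_ne_zero_stdGaussian] with x hx
  have hx0 : 0 < ‖x‖ := norm_pos_iff.2 hx
  rw [fderiv_radialExt_smul (t := R / ‖x‖) (by positivity) x, hsSq_smul, div_pow]
  ring

/-- Near zeros of `g` the field `f` need not be Lipschitz. Composing `g` with cut-off normalisations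
gives locally Lipschitz fields that eventually agree with `f` near almost every point, with
gradients dominated by ‖g‖⁻¹ times the Hilbert–Schmidt norm of the gradient of `g`. -/
theorem RadiallyRegular.of_normalize (hn : 3 ≤ n) (hR : 0 < R)
    (hg : LocallyLipschitzOn (Metric.sphere 0 R) g)
    (hfg : ∀ x ∈ Metric.sphere (0 : EuclideanSpace ℝ (Fin n)) R, g x ≠ 0 → f x = ‖g x‖⁻¹ • g x)
    (hg0 : ∀ᵐ x ∂sphereUniform n R, g x ≠ 0)
    (hint : Integrable (fun x => (‖radialExt R g x‖ ^ 2)⁻¹ *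
      hsSq (fderiv ℝ (radialExt R g) ((R / ‖x‖) • x)))
      (stdGaussian (EuclideanSpace ℝ (Fin n)))) : RadiallyRegular R f := by
  have := nontrivial_euclideanSpace hn
  obtain ⟨B, hB0, hB⟩ := exists_norm_fderiv_annularCutoff_le (EuclideanSpace ℝ (Fin n))
  have hν := scaleLipschitz_normalize (EuclideanSpace ℝ (Fin n))
  have hgR := RadiallyRegular.of_locallyLipschitzOn hn hR hg
  have hx0 : ∀ᵐ x ∂stdGaussian (EuclideanSpace ℝ (Fin n)), x ≠ 0 := ae_ne_zero_stdGaussian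
  have hgx0 : ∀ᵐ x ∂stdGaussian (EuclideanSpace ℝ (Fin n)), radialExt R g x ≠ 0 :=
    ae_of_ae_map measurable_div_norm_smul.aemeasurable hg0
  have hmeas : Measurable fun y : EuclideanSpace ℝ (Fin n) => ‖y‖⁻¹ • y := by fun_prop
  have hval : ∀ x : EuclideanSpace ℝ (Fin n), x ≠ 0 → radialExt R g x ≠ 0 →
      radialExt R f x = ‖radialExt R g x‖⁻¹ • radialExt R g x := fun x hx hgx =>
    hfg _ (smul_mem_sphere hR hx) hgx
  refine ⟨?_, ⟨1, ?_⟩, ?_, ?_, fun m => ?_⟩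
  · refine (hmeas.comp_aemeasurable
      hgR.aestronglyMeasurable.aemeasurable).aestronglyMeasurable.congr ?_
    filter_upwards [hg0, ae_norm_eq_sphereUniform hn hR] with x hx hxR
    exact (hfg x (mem_sphere_zero_iff_norm.2 hxR) hx).symm
  · filter_upwards [hx0, hgx0] with x hx hgx
    rw [hval x hx hgx]
    exact hν.norm_le _ hgx
  · filter_upwards [hx0, hgx0, hgR.differentiable] with x hx hgx hd
    refine DifferentiableAt.congr_of_eventuallyEq ?_
      (radialExt_eventuallyEq_normalize hR hfg hx hgx hd.continuousAt)
    exact (differentiableAt_normalize hgx).comp x hd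
  · refine Integrable.mono' (hint.const_mul (n * 4)) ?_ ?_
    · exact continuous_hsSq.comp_aestronglyMeasurable
        ((measurable_fderiv ℝ _).comp measurable_div_norm_smul).aestronglyMeasurable
    · filter_upwards [hx0, hgx0, hgR.differentiable] with x hx hgx hd
      have ht : 0 < R / ‖x‖ := div_pos hR (norm_pos_iff.2 hx)
      have hy0 : (R / ‖x‖) • x ≠ 0 := smul_ne_zero ht.ne' hx
      have h := norm_fderiv_radialExt_normalize_le hR hfg hy0 (by rwa [radialExt_smul ht])
        (differentiableAt_radialExt_smul ht hd)
      rw [radialExt_smul ht] at h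
      rw [Real.norm_of_nonneg (hsSq_nonneg _)]
      refine (hsSq_le _).trans ?_
      rw [Fintype.card_fin, mul_assoc]
      gcongr
      calc _ ≤ (2 / ‖radialExt R g x‖ * ‖fderiv ℝ (radialExt R g) ((R / ‖x‖) • x)‖) ^ 2 := by
            gcongr
        _ = 4 * ((‖radialExt R g x‖ ^ 2)⁻¹ *
            ‖fderiv ℝ (radialExt R g) ((R / ‖x‖) • x)‖ ^ 2) := by
            rw [mul_pow, div_pow]; ring
        _ ≤ _ := by gcongr; exact norm_sq_le_hsSq _
  · set φ : ℕ → EuclideanSpace ℝ (Fin n) → EuclideanSpace ℝ (Fin n) :=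
      fun k y => annularCutoff k y • ‖y‖⁻¹ • y with hφ
    have hφd : ∀ k y, y ≠ 0 → DifferentiableAt ℝ (φ k) y := fun k y hy =>
      ((contDiff_annularCutoff k).differentiable (by simp) y).smul (differentiableAt_normalize hy)
    have hφR : ∀ k, RadiallyRegular R (φ k ∘ g) := fun k => by
      obtain ⟨C, hC⟩ := hν.exists_lipschitzWith_annularCutoff_smul k
      obtain ⟨K, hK⟩ := hg.exists_lipschitzOnWith_of_compact (isCompact_sphere _ _)
      exact RadiallyRegular.of_locallyLipschitzOn hn hR
        fun x _ => ⟨_, _, self_mem_nhdsWithin, hC.comp_lipschitzOnWith hK⟩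
    have hint' := integrable_inv_norm_sq_mul_hsSq hn hR
      (fun t ht x => by rw [radialExt_smul ht]) hint
    have hev : ∀ x, radialExt R g x ≠ 0 → ∀ᶠ k in atTop,
        φ k =ᶠ[𝓝 (radialExt R g x)] fun y => ‖y‖⁻¹ • y := fun x hgx =>
      eventually_annularCutoff_smul_eventuallyEq _ hgx
    refine SteinPoincare.of_tendsto (M := 1 + ‖m‖)
      -- The constants 2 and 1 are those of `scaleLipschitz_normalize`.
      (w := fun x => (2 + B * 1) * (‖radialExt R g x‖⁻¹ * √(hsSq (fderiv ℝ (radialExt R g) x))))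
      (fun k => (hφR k).steinPoincare m) (fun k => ?_)
      (fun k => (measurable_fderiv ℝ _).aestronglyMeasurable) (fun k => ?_) (fun k => ?_) ?_ ?_ ?_
    · refine AEStronglyMeasurable.sub ?_ aestronglyMeasurable_const
      exact (hφR k).aestronglyMeasurable.comp_measurable measurable_div_norm_smul
    · refine .of_forall fun x => (norm_sub_le _ _).trans ?_
      gcongr
      exact hν.norm_annularCutoff_smul_le k _
    · filter_upwards [hgx0, hgR.differentiable] with x hgx hd
      change ‖fderiv ℝ (φ k ∘ radialExt R g) x‖ ≤ _
      rw [fderiv_comp x (hφd k _ hgx) hd]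
      refine (ContinuousLinearMap.opNorm_comp_le _ _).trans ?_
      have h1 := hν.norm_fderiv_annularCutoff_smul_le (hB k _ hgx) hgx
        (differentiableAt_normalize hgx)
      rw [← mul_assoc, ← div_eq_mul_inv]
      refine mul_le_mul h1 (Real.le_sqrt_of_sq_le (norm_sq_le_hsSq _)) (norm_nonneg _) ?_
      positivity
    · refine (hint'.const_mul ((2 + B * 1) ^ 2)).congr (.of_forall fun x => ?_)
      simp only [mul_pow, Real.sq_sqrt (hsSq_nonneg _), inv_pow]
    · filter_upwards [hx0, hgx0] with x hx hgx
      refine tendsto_const_nhds.congr' ?_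
      filter_upwards [hev x hgx] with k hk
      rw [hval x hx hgx]
      exact congrArg (· - m) hk.eq_of_nhds.symm
    · filter_upwards [hx0, hgx0, hgR.differentiable] with x hx hgx hd
      refine tendsto_const_nhds.congr' ?_
      filter_upwards [hev x hgx] with k hk
      exact ((radialExt_eventuallyEq_normalize hR hfg hx hgx hd.continuousAt).trans
        (hk.comp_tendsto hd.continuousAt).symm).fderiv_eq

end Normalized

/-! ### From Gaussian to spherical inequalities. -/

section SphericalInequalities

variable {n : ℕ} {R : ℝ} {f : EuclideanSpace ℝ (Fin n) → EuclideanSpace ℝ (Fin n)}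

/-- The derivative along the ray through `x` vanishes, so the gradient matrix is already tangential.
-/
lemma sphereGrad_transpose_mul_projPerp (x : EuclideanSpace ℝ (Fin n)) :
    (sphereGrad R f x)ᵀ * projPerp x = (sphereGrad R f x)ᵀ := by
  have h0 : ∀ i, ∑ k, fderiv ℝ (radialExt R f) x (EuclideanSpace.single k 1) i * x k = 0 := by
    intro i
    have hx : x = ∑ k, x k • EuclideanSpace.single k (1 : ℝ) := by
      ext j
      simp [Finset.sum_apply, Pi.single_apply]
    have h := congrArg (fun y => y i) (fderiv_radialExt_self (R := R) (f := f) x)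
    conv at h => enter [1, 1, 2]; rw [hx]
    simp only [map_sum, map_smul] at h
    simpa [Finset.sum_apply, mul_comm] using h
  rw [projPerp, Matrix.mul_sub, Matrix.mul_one, Matrix.mul_smul]
  have h1 : (sphereGrad R f x)ᵀ * Matrix.of (fun i j => x i * x j) = 0 := by
    ext i j
    simp only [Matrix.mul_apply, sphereGrad, Matrix.transpose_apply, Matrix.of_apply,
      Matrix.zero_apply]
    simp_rw [← mul_assoc]
    rw [← Finset.sum_mul, h0, zero_mul]
  rw [h1, smul_zero, sub_zero]

lemma trace_sphereGrad (x : EuclideanSpace ℝ (Fin n)) :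
    ((sphereGrad R f x)ᵀ * projPerp x).trace = euclTrace (fderiv ℝ (radialExt R f) x) := by
  rw [sphereGrad_transpose_mul_projPerp]
  rfl

lemma frobSq_sphereGrad (x : EuclideanSpace ℝ (Fin n)) :
    frobSq (sphereGrad R f x) = hsSq (fderiv ℝ (radialExt R f) x) := by
  rw [hsSq_eq_sum]; rfl

lemma frobSq_transpose (A : Matrix (Fin n) (Fin n) ℝ) : frobSq Aᵀ = frobSq A :=
  Finset.sum_comm

lemma frobSq_sphereGrad_mul_projPerp (x : EuclideanSpace ℝ (Fin n)) :
    frobSq ((sphereGrad R f x)ᵀ * projPerp x) = hsSq (fderiv ℝ (radialExt R f) x) := by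
  rw [sphereGrad_transpose_mul_projPerp, frobSq_transpose, frobSq_sphereGrad]

namespace RadiallyRegular

/-- The normal component of `f - m` times the radius, as a function on the punctured space. -/
noncomputable def normalPart (R : ℝ) (f : EuclideanSpace ℝ (Fin n) → EuclideanSpace ℝ (Fin n))
    (m x : EuclideanSpace ℝ (Fin n)) : ℝ :=
  inner ℝ (radialExt R f x - m) ((R / ‖x‖) • x)

/-- The divergence of the radial extension at the projection to the sphere. -/
noncomputable def sphereDiv (R : ℝ) (f : EuclideanSpace ℝ (Fin n) → EuclideanSpace ℝ (Fin n))
    (x : EuclideanSpace ℝ (Fin n)) : ℝ :=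
  euclTrace (fderiv ℝ (radialExt R f) ((R / ‖x‖) • x))

lemma normalPart_smul {m : EuclideanSpace ℝ (Fin n)} {t : ℝ} (ht : 0 < t)
    (x : EuclideanSpace ℝ (Fin n)) : normalPart R f m (t • x) = normalPart R f m x := by
  rw [normalPart, radialExt_smul ht, div_norm_smul_smul ht, normalPart]

lemma sphereDiv_smul {t : ℝ} (ht : 0 < t) (x : EuclideanSpace ℝ (Fin n)) :
    sphereDiv R f (t • x) = sphereDiv R f x := by
  rw [sphereDiv, div_norm_smul_smul ht, sphereDiv]

lemma aestronglyMeasurable_radialExt (hf : RadiallyRegular R f) :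
    AEStronglyMeasurable (radialExt R f) (stdGaussian (EuclideanSpace ℝ (Fin n))) :=
  hf.aestronglyMeasurable.comp_measurable measurable_div_norm_smul

lemma integrable_radialExt (hf : RadiallyRegular R f) :
    Integrable (radialExt R f) (stdGaussian (EuclideanSpace ℝ (Fin n))) := by
  obtain ⟨M, hM⟩ := hf.bounded
  exact Integrable.of_bound hf.aestronglyMeasurable_radialExt M hM

lemma memLp_normalPart (hn : 3 ≤ n) (hR : 0 < R) (hf : RadiallyRegular R f)
    (m : EuclideanSpace ℝ (Fin n)) :
    MemLp (normalPart R f m) 2 (stdGaussian (EuclideanSpace ℝ (Fin n))) := by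
  have := nontrivial_euclideanSpace hn
  obtain ⟨M, hM⟩ := hf.bounded
  refine MemLp.of_bound ?_ ((M + ‖m‖) * R) ?_
  · exact (hf.aestronglyMeasurable_radialExt.sub aestronglyMeasurable_const).inner
      measurable_div_norm_smul.aestronglyMeasurable
  · filter_upwards [hM, ae_ne_zero_stdGaussian] with x hx hx0
    refine (norm_inner_le_norm _ _).trans ?_
    rw [mem_sphere_zero_iff_norm.1 (smul_mem_sphere hR hx0)]
    gcongr
    exact (norm_sub_le _ _).trans (by gcongr)

lemma memLp_sphereDiv (hf : RadiallyRegular R f) :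
    MemLp (sphereDiv R f) 2 (stdGaussian (EuclideanSpace ℝ (Fin n))) := by
  have hmeas : AEStronglyMeasurable (sphereDiv R f) (stdGaussian (EuclideanSpace ℝ (Fin n))) :=
    continuous_euclTrace.comp_aestronglyMeasurable
      ((measurable_fderiv ℝ _).comp measurable_div_norm_smul).aestronglyMeasurable
  rw [memLp_two_iff_integrable_sq hmeas]
  refine Integrable.mono' (hf.integrable.const_mul ((n : ℝ) ^ 2)) (hmeas.pow 2)
    (.of_forall fun x => ?_)
  rw [norm_pow, Real.norm_eq_abs]
  calc |sphereDiv R f x| ^ 2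
      ≤ (n * ‖fderiv ℝ (radialExt R f) ((R / ‖x‖) • x)‖) ^ 2 := by
        gcongr
        simpa [sphereDiv] using abs_euclTrace_le (fderiv ℝ (radialExt R f) ((R / ‖x‖) • x))
    _ ≤ _ := by
        rw [mul_pow]
        gcongr
        exact norm_sq_le_hsSq _

lemma integral_hsSq_fderiv (hn : 3 ≤ n) (hR : 0 < R) :
    ∫ x, hsSq (fderiv ℝ (radialExt R f) x) ∂stdGaussian (EuclideanSpace ℝ (Fin n)) =
      R ^ 2 * ((n : ℝ) - 2)⁻¹ * ∫ x, hsSq (fderiv ℝ (radialExt R f) ((R / ‖x‖) • x))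
        ∂stdGaussian (EuclideanSpace ℝ (Fin n)) := by
  have := nontrivial_euclideanSpace hn
  have h := integral_radial_mul_stdGaussian (E := EuclideanSpace ℝ (Fin n))
    (q := fun r => (r ^ 2)⁻¹)
    (G := fun x => hsSq (fderiv ℝ (radialExt R f) ((R / ‖x‖) • x)))
    (fun t ht x => by rw [div_norm_smul_smul ht])
  rw [integral_inv_norm_sq_stdGaussian (by simpa using hn), finrank_euclideanSpace_fin] at h
  rw [mul_assoc, ← h, ← integral_const_mul]
  refine integral_congr_ae ?_
  filter_upwards [ae_ne_zero_stdGaussian] with x hx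
  have hx0 : 0 < ‖x‖ := norm_pos_iff.2 hx
  rw [fderiv_radialExt_smul (t := R / ‖x‖) (by positivity) x, hsSq_smul, div_pow]
  ring

/-- The spherical Poincaré-type inequality obtained from the Gaussian one. -/
theorem integral_norm_sub_sq_le (hn : 3 ≤ n) (hR : 0 < R) (hf : RadiallyRegular R f) :
    ∫ x, ‖radialExt R f x - ∫ y, radialExt R f y ∂stdGaussian (EuclideanSpace ℝ (Fin n))‖ ^ 2
        ∂stdGaussian (EuclideanSpace ℝ (Fin n)) ≤
      R ^ 2 * ((n : ℝ) - 2)⁻¹ * ∫ x, hsSq (fderiv ℝ (radialExt R f) ((R / ‖x‖) • x))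
        ∂stdGaussian (EuclideanSpace ℝ (Fin n)) := by
  rw [← integral_hsSq_fderiv hn hR]
  simpa using (hf.steinPoincare 0).poincare

/-- The inner product scales like ‖x‖ and the divergence like 1/‖x‖: the squares carry the radial
factors ‖x‖² and ‖x‖⁻², the cross term none. -/
lemma inner_sub_euclTrace_eq (hR : 0 < R) {m x : EuclideanSpace ℝ (Fin n)} (hx : x ≠ 0) :
    (inner ℝ (radialExt R f x - m) x - euclTrace (fderiv ℝ (radialExt R f) x)) ^ 2 =
      (R ^ 2)⁻¹ * (‖x‖ ^ 2 * normalPart R f m x ^ 2) -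
        2 * (normalPart R f m x * sphereDiv R f x) +
        R ^ 2 * ((‖x‖ ^ 2)⁻¹ * sphereDiv R f x ^ 2) := by
  have hx0 : 0 < ‖x‖ := norm_pos_iff.2 hx
  have h1 : inner ℝ (radialExt R f x - m) x = ‖x‖ / R * normalPart R f m x := by
    rw [normalPart, real_inner_smul_right]
    field_simp
  rw [h1, fderiv_radialExt_smul (t := R / ‖x‖) (by positivity) x, euclTrace_smul]
  change (‖x‖ / R * normalPart R f m x - R / ‖x‖ * sphereDiv R f x) ^ 2 = _
  field_simp
  ring

lemma integral_sub_add {α : Type*} [MeasurableSpace α] {μ : Measure α} {u v w : α → ℝ}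
    (hu : Integrable u μ) (hv : Integrable v μ) (hw : Integrable w μ) :
    ∫ x, (u x - v x + w x) ∂μ = ∫ x, u x ∂μ - ∫ x, v x ∂μ + ∫ x, w x ∂μ := by
  have huv : Integrable (fun x => u x - v x) μ := hu.sub hv
  rw [integral_add huv hw, integral_sub hu hv]

/-- The spherical second order Stein inequality obtained from the Gaussian one. -/
theorem integral_normalPart_sub_sphereDiv_sq_le (hn : 3 ≤ n) (hR : 0 < R)
    (hf : RadiallyRegular R f) :
    ∫ x, (normalPart R f (∫ y, radialExt R f y ∂stdGaussian (EuclideanSpace ℝ (Fin n))) x -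
        R ^ 2 * (n : ℝ)⁻¹ * sphereDiv R f x) ^ 2 ∂stdGaussian (EuclideanSpace ℝ (Fin n)) ≤
      2 * R ^ 4 * ((n : ℝ) ^ 2 - 2 * n)⁻¹ *
        ∫ x, hsSq (fderiv ℝ (radialExt R f) ((R / ‖x‖) • x))
          ∂stdGaussian (EuclideanSpace ℝ (Fin n)) := by
  have := nontrivial_euclideanSpace hn
  set m := ∫ y, radialExt R f y ∂stdGaussian (EuclideanSpace ℝ (Fin n)) with hm
  have hn' : (3 : ℝ) ≤ n := by exact_mod_cast hn
  have ha := memLp_normalPart hn hR hf m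
  have hD := memLp_sphereDiv hf
  have ia := ha.integrable_sq
  have iD := hD.integrable_sq
  have iaD : Integrable (fun x => normalPart R f m x * sphereDiv R f x)
      (stdGaussian (EuclideanSpace ℝ (Fin n))) := ha.integrable_mul hD
  have ga : ∀ t : ℝ, 0 < t → ∀ x, normalPart R f m (t • x) ^ 2 = normalPart R f m x ^ 2 :=
    fun t ht x => by rw [normalPart_smul ht]
  have gD : ∀ t : ℝ, 0 < t → ∀ x, sphereDiv R f (t • x) ^ 2 = sphereDiv R f x ^ 2 :=
    fun t ht x => by rw [sphereDiv_smul ht]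
  have ira := integrable_radial_mul_stdGaussian (q := fun r => r ^ 2)
    (G := fun x => normalPart R f m x ^ 2) ga
    (integrable_norm_pow_stdGaussian 2) ia
  have irD := integrable_radial_mul_stdGaussian (q := fun r => (r ^ 2)⁻¹)
    (G := fun x => sphereDiv R f x ^ 2) gD
    (integrable_inv_norm_sq_stdGaussian (by simpa using hn)) iD
  have era := integral_radial_mul_stdGaussian (q := fun r => r ^ 2)
    (G := fun x => normalPart R f m x ^ 2) ga
  have erD := integral_radial_mul_stdGaussian (q := fun r => (r ^ 2)⁻¹)
    (G := fun x => sphereDiv R f x ^ 2) gD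
  rw [integral_norm_sq_stdGaussian, finrank_euclideanSpace_fin] at era
  rw [integral_inv_norm_sq_stdGaussian (by simpa using hn), finrank_euclideanSpace_fin] at erD
  set A := ∫ x, normalPart R f m x ^ 2 ∂stdGaussian (EuclideanSpace ℝ (Fin n)) with hA
  set B := ∫ x, normalPart R f m x * sphereDiv R f x ∂stdGaussian (EuclideanSpace ℝ (Fin n))
    with hB
  set C := ∫ x, sphereDiv R f x ^ 2 ∂stdGaussian (EuclideanSpace ℝ (Fin n)) with hC
  set H := ∫ x, hsSq (fderiv ℝ (radialExt R f) ((R / ‖x‖) • x))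
          ∂stdGaussian (EuclideanSpace ℝ (Fin n)) with hH
  have hC0 : 0 ≤ C := integral_nonneg fun _ => sq_nonneg _
  -- the Gaussian second order Stein and Poincaré inequalities
  have hst := (hf.steinPoincare m).stein
  have hpo := integral_norm_sub_sq_le hn hR hf
  rw [integral_hsSq_fderiv hn hR, ← hH] at hst
  rw [← hm, ← hH] at hpo
  have e1 : ∫ x, (inner ℝ (radialExt R f x - m) x - euclTrace (fderiv ℝ (radialExt R f) x)) ^ 2
      ∂stdGaussian (EuclideanSpace ℝ (Fin n)) =
      (R ^ 2)⁻¹ * (n * A) - 2 * B + R ^ 2 * (((n : ℝ) - 2)⁻¹ * C) := by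
    rw [← era, ← erD, hB, ← integral_const_mul, ← integral_const_mul, ← integral_const_mul,
      ← integral_sub_add (ira.const_mul _) (iaD.const_mul _) (irD.const_mul _)]
    refine integral_congr_ae ?_
    filter_upwards [ae_ne_zero_stdGaussian] with x hx
    exact inner_sub_euclTrace_eq hR hx
  have e2 : ∫ x, (normalPart R f m x - R ^ 2 * (n : ℝ)⁻¹ * sphereDiv R f x) ^ 2
      ∂stdGaussian (EuclideanSpace ℝ (Fin n)) =
      A - 2 * (R ^ 2 * (n : ℝ)⁻¹) * B + (R ^ 2 * (n : ℝ)⁻¹) ^ 2 * C := by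
    rw [hA, hB, hC, ← integral_const_mul, ← integral_const_mul,
      ← integral_sub_add ia (iaD.const_mul _) (iD.const_mul _)]
    exact integral_congr_ae (.of_forall fun x => by ring)
  rw [e1] at hst
  rw [e2]
  have hn0 : (0 : ℝ) < n := by linarith
  have hn2 : (0 : ℝ) < n - 2 := by linarith
  -- The factor 2 arises because Poincaré bounds the variance term by the gradient term.
  have key : (R ^ 2)⁻¹ * (n * A) - 2 * B + R ^ 2 * (((n : ℝ) - 2)⁻¹ * C) ≤
      2 * (R ^ 2 * ((n : ℝ) - 2)⁻¹ * H) := by linarith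
  -- Lowering 1/(n-2) to 1/n is what completes the square.
  have hCC : (n : ℝ)⁻¹ * C ≤ ((n : ℝ) - 2)⁻¹ * C := by
    gcongr
    linarith
  calc A - 2 * (R ^ 2 * (n : ℝ)⁻¹) * B + (R ^ 2 * (n : ℝ)⁻¹) ^ 2 * C
      = R ^ 2 * (n : ℝ)⁻¹ * ((R ^ 2)⁻¹ * (n * A) - 2 * B + R ^ 2 * ((n : ℝ)⁻¹ * C)) := by
        field_simp
    _ ≤ R ^ 2 * (n : ℝ)⁻¹ * (2 * (R ^ 2 * ((n : ℝ) - 2)⁻¹ * H)) := by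
        gcongr
        refine le_trans ?_ key
        gcongr
    _ = _ := by
        rw [show (n : ℝ) ^ 2 - 2 * n = n * (n - 2) by ring, mul_inv]
        ring

end RadiallyRegular

end SphericalInequalities

/-! ### Passing between `z` and the Gaussian vector. -/

section Transfer

variable {Ω : Type*} [MeasurableSpace Ω] {P : Measure Ω} {n : ℕ} {R : ℝ}
  {z : Ω → EuclideanSpace ℝ (Fin n)} {f : EuclideanSpace ℝ (Fin n) → EuclideanSpace ℝ (Fin n)}

lemma integral_comp_eq_integral_stdGaussian {F : Type*} [NormedAddCommGroup F] [NormedSpace ℝ F]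
    (hz : HasLaw z (sphereUniform n R) P) {Φ : EuclideanSpace ℝ (Fin n) → F}
    (hΦ : AEStronglyMeasurable Φ (sphereUniform n R)) :
    ∫ ω, Φ (z ω) ∂P =
      ∫ x, Φ ((R / ‖x‖) • x) ∂stdGaussian (EuclideanSpace ℝ (Fin n)) := by
  have h1 : ∫ ω, Φ (z ω) ∂P = ∫ x, Φ x ∂sphereUniform n R := hz.integral_comp hΦ
  rw [h1]
  exact integral_map measurable_div_norm_smul.aemeasurable hΦ

lemma integrable_comp_iff_integrable_stdGaussian {F : Type*} [NormedAddCommGroup F]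
    (hz : HasLaw z (sphereUniform n R) P) {Φ : EuclideanSpace ℝ (Fin n) → F}
    (hΦ : AEStronglyMeasurable Φ (sphereUniform n R)) :
    Integrable (fun ω => Φ (z ω)) P ↔
      Integrable (fun x => Φ ((R / ‖x‖) • x)) (stdGaussian (EuclideanSpace ℝ (Fin n))) := by
  have h1 := integrable_map_measure hΦ measurable_div_norm_smul.aemeasurable
  have hΦ' := hΦ
  rw [← hz.map_eq] at hΦ'
  have h2 := integrable_map_measure hΦ' hz.aemeasurable
  rw [hz.map_eq] at h2
  exact h2.symm.trans h1

/-- The set where `f` vanishes need not be measurable, so the transfer goes through a strongly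
measurable representative. -/
lemma ae_sphereUniform_ne_zero_of_ae_comp (hz : HasLaw z (sphereUniform n R) P)
    (hf : AEStronglyMeasurable f (sphereUniform n R)) (h : ∀ᵐ ω ∂P, f (z ω) ≠ 0) :
    ∀ᵐ x ∂sphereUniform n R, f x ≠ 0 := by
  obtain ⟨g, hg, hfg⟩ := hf
  have h1 : ∀ᵐ ω ∂P, f (z ω) = g (z ω) :=
    ae_of_ae_map hz.aemeasurable (by rw [hz.map_eq]; exact hfg)
  have h2 : ∀ᵐ ω ∂P, g (z ω) ≠ 0 := by
    filter_upwards [h, h1] with ω hω hω'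
    rwa [← hω']
  have h3 : ∀ᵐ x ∂sphereUniform n R, g x ≠ 0 := by
    rw [← hz.map_eq]
    exact (ae_map_iff hz.aemeasurable (hg.measurable (measurableSet_singleton 0).compl)).2 h2
  filter_upwards [h3, hfg] with x hx hx'
  rwa [hx']

lemma measurable_hsSq_fderiv_radialExt :
    Measurable fun x => hsSq (fderiv ℝ (radialExt R f) x) :=
  (continuous_hsSq (ι := Fin n)).measurable.comp (measurable_fderiv ℝ _)

lemma RadiallyRegular.of_hasLaw (hn : 3 ≤ n) (hR : 0 < R) (hz : HasLaw z (sphereUniform n R) P)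
    (hf :
      LocallyLipschitzOn (Metric.sphere 0 R) f ∨
      (∃ g : EuclideanSpace ℝ (Fin n) → EuclideanSpace ℝ (Fin n),
        LocallyLipschitzOn (Metric.sphere 0 R) g ∧
        (∀ x ∈ Metric.sphere (0 : EuclideanSpace ℝ (Fin n)) R,
          g x ≠ 0 → f x = ‖g x‖⁻¹ • g x) ∧
        (∀ᵐ ω ∂P, g (z ω) ≠ 0) ∧
        Integrable (fun ω => (‖g (z ω)‖ ^ 2)⁻¹ * frobSq (sphereGrad R g (z ω))) P)) :
    RadiallyRegular R f := by
  rcases hf with hf | ⟨g, hg, hfg, hg0, hint⟩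
  · exact .of_locallyLipschitzOn hn hR hf
  · have hgm := aestronglyMeasurable_sphereUniform_of_locallyLipschitzOn hn hR hg
    refine .of_normalize hn hR hg hfg (ae_sphereUniform_ne_zero_of_ae_comp hz hgm hg0) ?_
    simp_rw [frobSq_sphereGrad] at hint
    refine (integrable_comp_iff_integrable_stdGaussian hz
      (Φ := fun x => (‖g x‖ ^ 2)⁻¹ * hsSq (fderiv ℝ (radialExt R g) x)) ?_).1 hint
    exact ((hgm.norm.aemeasurable.pow_const 2).inv.mul
      measurable_hsSq_fderiv_radialExt.aemeasurable).aestronglyMeasurable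

lemma sq_integral_le_integral_sq [IsProbabilityMeasure P] {Y : Ω → ℝ} (hY : MemLp Y 2 P) :
    (∫ ω, Y ω ∂P) ^ 2 ≤ ∫ ω, Y ω ^ 2 ∂P := by
  have h := variance_nonneg Y P
  rw [variance_eq_sub hY] at h
  simpa using h

end Transfer

/-! ### The main theorem. -/

theorem mainTheorem4 {Ω : Type*} [MeasurableSpace Ω] (P : Measure Ω) [IsProbabilityMeasure P]
    (n : ℕ) (hn : 3 ≤ n) (R : ℝ) (hR : 0 < R)
    (z : Ω → EuclideanSpace ℝ (Fin n)) (hz : HasLaw z (sphereUniform n R) P)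
    (f : EuclideanSpace ℝ (Fin n) → EuclideanSpace ℝ (Fin n))
    (hf :
      (LocallyLipschitzOn (Metric.sphere 0 R) f ∧
        Integrable (fun ω => frobSq (sphereGrad R f (z ω))ᵀ) P) ∨
      (∃ g : EuclideanSpace ℝ (Fin n) → EuclideanSpace ℝ (Fin n),
        LocallyLipschitzOn (Metric.sphere 0 R) g ∧
        (∀ x ∈ Metric.sphere (0 : EuclideanSpace ℝ (Fin n)) R,
          g x ≠ 0 → f x = ‖g x‖⁻¹ • g x) ∧
        (∀ᵐ ω ∂P, g (z ω) ≠ 0) ∧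
        Integrable (fun ω => (‖g (z ω)‖ ^ 2)⁻¹ * frobSq (sphereGrad R g (z ω))) P)) :
    -- all quantities below are well defined
    (∀ᵐ ω ∂P, DifferentiableAt ℝ (radialExt R f) (z ω)) ∧
    Integrable (fun ω => f (z ω)) P ∧
    Integrable (fun ω => frobSq ((sphereGrad R f (z ω))ᵀ * projPerp (z ω))) P ∧
    Integrable (fun ω => (xiStein R f (z ω) - inner ℝ (∫ ω', f (z ω') ∂P) (z ω)) ^ 2) P ∧
    Integrable (fun ω => |‖f (z ω)‖ - ‖∫ ω', f (z ω') ∂P‖| ^ 2) P ∧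
    -- first inequality
    (∫ ω, (xiStein R f (z ω) - inner ℝ (∫ ω', f (z ω') ∂P) (z ω)) ^ 2 ∂P ≤
      2 * R ^ 4 * ((n : ℝ) ^ 2 - 2 * n)⁻¹ *
        ∫ ω, frobSq ((sphereGrad R f (z ω))ᵀ * projPerp (z ω)) ∂P) ∧
    -- second inequality, for the squared mean deviation and for the mean squared deviation
    ((∫ ω, |‖f (z ω)‖ - ‖∫ ω', f (z ω') ∂P‖| ∂P) ^ 2 ≤
      R ^ 2 * ((n : ℝ) - 2)⁻¹ *
        ∫ ω, frobSq ((sphereGrad R f (z ω))ᵀ * projPerp (z ω)) ∂P) ∧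
    (∫ ω, |‖f (z ω)‖ - ‖∫ ω', f (z ω') ∂P‖| ^ 2 ∂P ≤
      R ^ 2 * ((n : ℝ) - 2)⁻¹ *
        ∫ ω, frobSq ((sphereGrad R f (z ω))ᵀ * projPerp (z ω)) ∂P) := by
  have hreg : RadiallyRegular R f := .of_hasLaw hn hR hz (hf.imp_left And.left)
  have := nontrivial_euclideanSpace hn
  have hfm := hreg.aestronglyMeasurable
  have hmean : ∫ ω', f (z ω') ∂P =
      ∫ x, radialExt R f x ∂stdGaussian (EuclideanSpace ℝ (Fin n)) :=
    integral_comp_eq_integral_stdGaussian hz hfm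
  set m := ∫ x, radialExt R f x ∂stdGaussian (EuclideanSpace ℝ (Fin n)) with hm
  simp_rw [hmean, frobSq_sphereGrad_mul_projPerp]
  have hhsm : AEStronglyMeasurable (fun x => hsSq (fderiv ℝ (radialExt R f) x))
      (sphereUniform n R) := measurable_hsSq_fderiv_radialExt.aestronglyMeasurable
  have hxim : AEStronglyMeasurable (fun x => (xiStein R f x - inner ℝ m x) ^ 2)
      (sphereUniform n R) := by
    unfold xiStein
    simp_rw [trace_sphereGrad]
    refine AEStronglyMeasurable.pow (((hfm.inner aestronglyMeasurable_id).sub ?_).sub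
      (aestronglyMeasurable_const.inner aestronglyMeasurable_id)) 2
    exact (((continuous_euclTrace (ι := Fin n)).measurable.comp
      (measurable_fderiv ℝ _)).const_mul _).aestronglyMeasurable
  have hxi : ∀ x, (xiStein R f ((R / ‖x‖) • x) - inner ℝ m ((R / ‖x‖) • x)) ^ 2 =
      (RadiallyRegular.normalPart R f m x -
        R ^ 2 * (n : ℝ)⁻¹ * RadiallyRegular.sphereDiv R f x) ^ 2 := fun x => by
    rw [xiStein, trace_sphereGrad, RadiallyRegular.normalPart, inner_sub_left,
      RadiallyRegular.sphereDiv, radialExt]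
    ring
  have hdevm : AEStronglyMeasurable (fun x => |‖f x‖ - ‖m‖|) (sphereUniform n R) :=
    (hfm.norm.sub aestronglyMeasurable_const).norm
  obtain ⟨M, hM⟩ := hreg.bounded
  have hdevLp : MemLp (fun ω => |‖f (z ω)‖ - ‖m‖|) 2 P := by
    have hb : MemLp (fun x => |‖f x‖ - ‖m‖|) 2 (sphereUniform n R) := by
      have hb' : MemLp (fun x => |‖radialExt R f x‖ - ‖m‖|) 2
          (stdGaussian (EuclideanSpace ℝ (Fin n))) := by
        refine MemLp.of_bound (hdevm.comp_measurable measurable_div_norm_smul) (M + ‖m‖) ?_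
        filter_upwards [hM] with x hx
        rw [Real.norm_eq_abs, abs_abs]
        refine (abs_norm_sub_norm_le _ _).trans ((norm_sub_le _ _).trans ?_)
        gcongr
      exact (memLp_map_measure_iff hdevm measurable_div_norm_smul.aemeasurable).2 hb'
    rw [← hz.map_eq] at hb hdevm
    exact (memLp_map_measure_iff hdevm hz.aemeasurable).1 hb
  have hsecond : ∫ ω, |‖f (z ω)‖ - ‖m‖| ^ 2 ∂P ≤ R ^ 2 * ((n : ℝ) - 2)⁻¹ *
      ∫ ω, hsSq (fderiv ℝ (radialExt R f) (z ω)) ∂P := by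
    rw [integral_comp_eq_integral_stdGaussian hz hhsm,
      integral_comp_eq_integral_stdGaussian hz (Φ := fun x => |‖f x‖ - ‖m‖| ^ 2) (hdevm.pow 2)]
    -- The reverse triangle inequality |‖f‖ - ‖m‖| ≤ ‖f - m‖ reduces the claim to the variance
    -- bound.
    refine le_trans ?_ (RadiallyRegular.integral_norm_sub_sq_le hn hR hreg)
    refine integral_mono_of_nonneg (.of_forall fun x => sq_nonneg _) ?_ (.of_forall fun x => ?_)
    · refine Integrable.of_bound (C := (M + ‖m‖) ^ 2)
        ((hreg.aestronglyMeasurable_radialExt.sub aestronglyMeasurable_const).norm.pow 2) ?_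
      filter_upwards [hM] with x hx
      rw [norm_pow, norm_norm]
      gcongr
      exact (norm_sub_le _ _).trans (by gcongr)
    · exact pow_le_pow_left₀ (abs_nonneg _) (abs_norm_sub_norm_le _ _) 2
  refine ⟨?_, ?_, ?_, ?_, hdevLp.integrable_sq, ?_, ?_, hsecond⟩
  · refine ae_of_ae_map hz.aemeasurable ?_
    rw [hz.map_eq, sphereUniform, ae_map_iff measurable_div_norm_smul.aemeasurable
      (measurableSet_of_differentiableAt ℝ _)]
    filter_upwards [hreg.differentiable, ae_ne_zero_stdGaussian] with x hx hx0
    exact differentiableAt_radialExt_smul (div_pos hR (norm_pos_iff.2 hx0)) hx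
  · exact (integrable_comp_iff_integrable_stdGaussian hz hfm).2 hreg.integrable_radialExt
  · exact (integrable_comp_iff_integrable_stdGaussian hz hhsm).2 hreg.integrable
  · refine (integrable_comp_iff_integrable_stdGaussian hz hxim).2 ?_
    simp_rw [hxi]
    exact ((hreg.memLp_normalPart hn hR m).sub
      (hreg.memLp_sphereDiv.const_mul _)).integrable_sq
  · rw [integral_comp_eq_integral_stdGaussian hz hxim,
      integral_comp_eq_integral_stdGaussian hz hhsm]
    simp_rw [hxi]
    exact hreg.integral_normalPart_sub_sphereDiv_sq_le hn hR
  · exact (sq_integral_le_integral_sq hdevLp).trans hsecond
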